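/- **Setting.** Base stations (BSs) with transmit power $P>0$ form a homogeneous Poisson point process of density $\lambda>0$ on $\mathbb R^2$. A fixed user is served by its nearest BS, labelled $\mathrm{BS}_0$; the remaining BSs $\mathrm{BS}_1,\mathrm{BS}_2,\dots$ interfere. Let $r_i$ be the horizontal distance from $\mathrm{BS}_i$ to the user, $\Delta h>0$ the antenna height difference, and $d_i=\sqrt{r_i^2+\Delta h^2}$. Let $N\ge1$, $0=R_0<R_1<\dots<R_N=\infty$, $0\le\alpha_0\le\dots\le\alpha_{N-1}$ with $\alpha_{N-1}>2$, and $K_n=\prod_{i=1}^{n}R_i^{\alpha_i-\alpha_{i-1}}$ (so $K_0=1$). The multi-slope pathloss at antenna distance $x$ is $$l_N(x)=K_nx^{-\alpha_n}\quad\text{for } b_n\le x<b_{n+1},$$ where either $b_n=\bar R_n:=\sqrt{R_n^2+\Delta h^2}$ (the thresholds $R_n$ refer to the horizontal distance) or $b_n=R_n$ (they refer to the antenna distance); $b_N=\infty$. The channel power gains $g_0,g_1,g_2,\dots$ are independent of each other and of the BS locations. The interfering gains $g_i$, $i\ge1$, are $\chi^2_2$, and the desired gain, which is $\chi^2_{2N_{\mathrm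 a}}$ for beamforming with $N_{\mathrm a}\ge1$ antennas, is replaced by an exponential variable $g_0$ with mean $2N_{\mathrm a}$. For a threshold $\tau>0$ put $$\mathsf{SIR}=\frac{P g_0\,l_N(d_0)}{\sum_{i\ge1}P g_i\,l_N(d_i)},\qquad \tilde{\mathsf{CP}}^{\mathrm M}_N(\lambda)=\mathbb P\{\mathsf{SIR}>\tau\},\qquad \tilde{\mathsf{ST}}^{\mathrm M}_N(\lambda)=\lambda\,\mathbb P\{\mathsf{SIR}>\tau\}\log_2(1+\tau).$$ With ${}_2F_1$ the Gaussian hypergeometric function let $\omega_1(x,y)={}_2F_1(1,1-\tfrac2y;2-\tfrac2y;-x)$, $\omega_2(x,y)={}_2F_1(1,\tfrac2y;1+\tfrac2y;-x)$ (with $\omega_2(x,0)=\frac1{1+x}$, its limit as $y\downarrow0$), $\delta(x,y)=\frac{2x\,\omega_1(x,y)}{y-2}$, and $\tau^\dagger=\tau/N_{\mathrm a}$. **Claim.** The distance $r_0$ has density $2\pi\lambda x e^{-\pi\lambda x^2}$, $x\ge0$. If $N=1$, then $$\tilde{\mathsf{CP}}^{\mathrm M}_1(\lambda)=\frac{\exp\!\left(-\pi\lambda\,\delta(\tau^\dagger,\alpha_0)\,\Delta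 h^2\right)}{1+\delta(\tau^\dagger,\alpha_0)}.$$ If $N>1$, then $$\tilde{\mathsf{CP}}^{\mathrm M}_N(\lambda)=\sum_{n=0}^{N-1}\mathbb E\Big[\mathbf 1_{\{b_n\le d_0<b_{n+1}\}}\,e^{-\pi\lambda E_n}\Big],$$ $$E_n=b_{n+1}^2\,\omega_2\!\Big(\tfrac{b_{n+1}^{\alpha_n}}{\tau^\dagger d_0^{\alpha_n}},\alpha_n\Big)-d_0^2\,\omega_2\!\Big(\tfrac1{\tau^\dagger},\alpha_n\Big)+\sum_{i=n+1}^{N-1}\Big[b_{i+1}^2\,\omega_2\!\Big(\tfrac{b_{i+1}^{\alpha_i}}{c_{n,i}},\alpha_i\Big)-b_i^2\,\omega_2\!\Big(\tfrac{b_i^{\alpha_i}}{c_{n,i}},\alpha_i\Big)\Big],\qquad c_{n,i}=\tau^\dagger\,\frac{K_i}{K_n}\,d_0^{\alpha_n},$$ where the terms with $b_N=\infty$ stand for their limits as $b_N\to\infty$; these limits exist. (For $b_n=\bar R_n$ the event $b_n\le d_0<b_{n+1}$ is $R_n\le r_0<R_{n+1}$.) In all cases $\tilde{\mathsf{ST}}^{\mathrm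 M}_N(\lambda)=\lambda\,\tilde{\mathsf{CP}}^{\mathrm M}_N(\lambda)\log_2(1+\tau)$ with $\tilde{\mathsf{CP}}^{\mathrm M}_N(\lambda)$ given by these formulas. -/

import Mathlib

open MeasureTheory ProbabilityTheory Filter Topology

noncomputable section

namespace CellNet

/-! ### Hypergeometric functions -/

/-- The Gaussian hypergeometric function `₂F₁(a, b; c; z)` of real arguments with `0 < b < c` and
`z < 1`, given by Euler's integral. Mathlib's `ordinaryHypergeometric` is the sum of the power
series, hence only meaningful for `|z| < 1`; here arguments `z < -1` are needed as well. -/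
def gaussHyp (a b c z : ℝ) : ℝ :=
  Real.Gamma c / (Real.Gamma b * Real.Gamma (c - b)) *
    ∫ t in (0 : ℝ)..1, t ^ (b - 1) * (1 - t) ^ (c - b - 1) * (1 - z * t) ^ (-a)

/-- `ω₁(x, y) = ₂F₁(1, 1 - 2/y; 2 - 2/y; -x)`, used for `y > 2`. -/
def omega1 (x y : ℝ) : ℝ := gaussHyp 1 (1 - 2 / y) (2 - 2 / y) (-x)

/-- `ω₂(x, y) = ₂F₁(1, 2/y; 1 + 2/y; -x)` for `y > 0`; at `y = 0` (a slope with pathloss exponent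
zero) its value is the limit as `y` decreases to `0`, namely `1 / (1 + x)`. -/
def omega2 (x y : ℝ) : ℝ :=
  if y = 0 then 1 / (1 + x) else gaussHyp 1 (2 / y) (1 + 2 / y) (-x)

/-- `δ(x, y) = 2 x ω₁(x, y) / (y - 2)`. -/
def delta (x y : ℝ) : ℝ := 2 * x * omega1 x y / (y - 2)

/-! ### Multi-slope pathloss -/

/-- `K n = ∏_{i = 1}^{n} R_i ^ (α_i - α_{i-1})`, so `K 0 = 1`. -/
def slopeConst (R α : ℕ → ℝ) (n : ℕ) : ℝ :=
  ∏ i ∈ Finset.range n, R (i + 1) ^ (α (i + 1) - α i)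

/-- The `n`-th of the `N` bands (`n < N`) with lower edges `b 0, …, b (N - 1)`: the interval
`[b n, b (n + 1))`, with upper end `∞` for the last one. -/
def band (N : ℕ) (b : ℕ → ℝ) (n : ℕ) : Set ℝ := {x | b n ≤ x ∧ (n + 1 < N → x < b (n + 1))}

open Classical in
/-- The pathloss at antenna distance `x`: it is `K n * x ^ (-α n)` when `x` is in the `n`-th band
of the edges `b`. -/
def pathloss (N : ℕ) (R α b : ℕ → ℝ) (x : ℝ) : ℝ :=
  ∑ n ∈ Finset.range N, if x ∈ band N b n then slopeConst R α n * x ^ (-α n) else 0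

/-- Antenna distance `√(r² + Δh²)` at horizontal distance `r` and antenna height difference `Δh`. -/
def antennaDist (Δh r : ℝ) : ℝ := √(r ^ 2 + Δh ^ 2)

/-! ### Poisson point processes -/

/-- The number of points of the random sequence `X` in `A`, with multiplicity. -/
def pointCount {Ω E : Type*} (X : ℕ → Ω → E) (A : Set E) (ω : Ω) : ℕ∞ :=
  Set.encard {i | X i ω ∈ A}

/-- The points `X 0, X 1, …` form a Poisson point process with intensity measure `ν`. -/
structure IsPoissonPointProcess {Ω E : Type*} [MeasurableSpace Ω] [MeasurableSpace E]
    (μ : Measure Ω) (X : ℕ → Ω → E) (ν : Measure E) : Prop where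
  measurable : ∀ i, Measurable (X i)
  count_law : ∀ A : Set E, MeasurableSet A → ν A < ⊤ → ∀ k : ℕ,
    μ {ω | pointCount X A ω = k} = poissonMeasure (ν A).toNNReal {k}
  indep : ∀ (m : ℕ) (A : Fin m → Set E), (∀ j, MeasurableSet (A j)) →
    Pairwise (fun i j => Disjoint (A i) (A j)) →
      iIndepFun (fun j ω => pointCount X (A j) ω) μ

/-- The chi-square distribution with `k` degrees of freedom. -/
def chiSquare (k : ℕ) : Measure ℝ := gammaMeasure (k / 2) (1 / 2)

/-! ### Signal-to-interference ratio, coverage probability and spatial throughput -/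

section Network

variable {Ω : Type*} [MeasurableSpace Ω]

/-- Horizontal distance from the user at `u` to the base station `BS i`. -/
def horizDist (u : EuclideanSpace ℝ (Fin 2)) (BS : ℕ → Ω → EuclideanSpace ℝ (Fin 2))
    (i : ℕ) (ω : Ω) : ℝ := dist (BS i ω) u

/-- Power received from `BS i`: transmit power times channel power gain times pathloss. -/
def receivedPower (N : ℕ) (R α b : ℕ → ℝ) (P Δh : ℝ) (u : EuclideanSpace ℝ (Fin 2))
    (BS : ℕ → Ω → EuclideanSpace ℝ (Fin 2)) (g : ℕ → Ω → ℝ) (i : ℕ) (ω : Ω) : ℝ :=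
  P * g i ω * pathloss N R α b (antennaDist Δh (horizDist u BS i ω))

/-- The signal-to-interference ratio of a user served by `BS 0`. The interference is the sum over
all other base stations. -/
def sir (N : ℕ) (R α b : ℕ → ℝ) (P Δh : ℝ) (u : EuclideanSpace ℝ (Fin 2))
    (BS : ℕ → Ω → EuclideanSpace ℝ (Fin 2)) (g : ℕ → Ω → ℝ) (ω : Ω) : ENNReal :=
  ENNReal.ofReal (receivedPower N R α b P Δh u BS g 0 ω) /
    ∑' i : ℕ, ENNReal.ofReal (receivedPower N R α b P Δh u BS g (i + 1) ω)

/-- Coverage probability `ℙ(SIR > τ)`. -/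
def coverageProb (μ : Measure Ω) (SIR : Ω → ENNReal) (τ : ℝ) : ℝ :=
  μ.real {ω | ENNReal.ofReal τ < SIR ω}

/-- Network spatial throughput `λ ℙ(SIR > τ) log₂(1 + τ)`. -/
def spatialThroughput (μ : Measure Ω) (SIR : Ω → ENNReal) (lam τ : ℝ) : ℝ :=
  lam * coverageProb μ SIR τ * Real.logb 2 (1 + τ)

end Network

/-! ### The analytic expression -/

/-- The density `2πλ x exp(-πλ x²)`, `x ≥ 0`, of the distance to the nearest base station. -/
def contactPDF (lam x : ℝ) : ℝ :=
  if 0 ≤ x then 2 * Real.pi * lam * x * Real.exp (-Real.pi * lam * x ^ 2) else 0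

/-- `b ^ 2 * ω₂(b ^ α i / c, α i)` at the upper edge `b = b (i + 1)` of the `i`-th band; for the
last band, whose upper edge is `∞`, this is the limit as the edge tends to `∞`. -/
def upperTerm (N : ℕ) (α b : ℕ → ℝ) (c : ℝ) (i : ℕ) : ℝ :=
  if i + 1 < N then b (i + 1) ^ 2 * omega2 (b (i + 1) ^ α i / c) (α i)
  else limUnder atTop (fun x : ℝ => x ^ 2 * omega2 (x ^ α i / c) (α i))

/-- `b i ^ 2 * ω₂(b i ^ α i / c, α i)` at the lower edge `b i` of the `i`-th band. -/
def lowerTerm (α b : ℕ → ℝ) (c : ℝ) (i : ℕ) : ℝ :=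
  b i ^ 2 * omega2 (b i ^ α i / c) (α i)

/-- The factor of `-πλ` in the exponent, for a serving base station at antenna distance `d` in the
`n`-th band and threshold `t`. -/
def exponentTerm (N : ℕ) (R α b : ℕ → ℝ) (t d : ℝ) (n : ℕ) : ℝ :=
  upperTerm N α b (t * d ^ α n) n - d ^ 2 * omega2 (1 / t) (α n) +
    ∑ i ∈ Finset.Ico (n + 1) N,
      (upperTerm N α b (t * (slopeConst R α i / slopeConst R α n) * d ^ α n) i -
        lowerTerm α b (t * (slopeConst R α i / slopeConst R α n) * d ^ α n) i)

/-- The coverage formula at density `lam` and threshold `t`. In the case of more than one slope the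
integral is the (unnormalised) expectation over the horizontal serving distance `r₀` restricted to
`d₀ = √(r₀² + Δh²)` in the `n`-th band. -/
def coverageFormula (N : ℕ) (R α b : ℕ → ℝ) (Δh lam t : ℝ) : ℝ :=
  if N = 1 then
    1 / (1 + delta t (α 0)) * Real.exp (-Real.pi * lam * delta t (α 0) * Δh ^ 2)
  else
    ∑ n ∈ Finset.range N, ∫ r in {r : ℝ | 0 ≤ r ∧ antennaDist Δh r ∈ band N b n},
      Real.exp (-Real.pi * lam * exponentTerm N R α b t (antennaDist Δh r) n) * contactPDF lam r

end CellNet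

end

/-! The probability of coverage is computed for fixed base station locations and then averaged over
them. The desired gain is exponential, so `ℙ(g₀ > T) = exp(-T / (2 Na))`, and coverage given the
locations is a Laplace transform of the interference. The interfering gains are independent and
exponential with mean 2, so this transform is `∏_{i ≥ 1} (1 + τ† l(dᵢ) / l(d₀))⁻¹` with `τ† = τ /
Na` (`measure_tsum_lt_ofReal`, `measure_lt_sir`).

The product depends on the locations only through the squared horizontal distances `ρᵢ`. A disc of
radius `√c` has area `π c`, so these form a homogeneous Poisson process on `[0, ∞)` of rate `κ = π
λ` (`map_sq_dist_volume`). For a fixed weight `h`, adding the weight `∞` on `[0, a)` in the Laplace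
functional gives `𝔼[1_{ρ₀ ≥ a} exp(-∑ h(ρᵢ))] = exp(-κ (a + ∫_a^∞ (1 - e^{-h})))`. This is the tail
of the law of `ρ₀` under a weighted measure. Its density contains the factor `e^{-h(v)}` of the
nearest point itself; cancelling it leaves `exp(-κ ∫_{ρ₀}^∞ (1 - e^{-h}))` for the other points
(`lintegral_mul_nexp_tsum_succ`). The weight that is needed depends on `ρ₀` through `1 / l(d₀)`,
which is reached by approximation with simple functions (`lintegral_nexp_tsum_nearest`).

Shifting by `Δh²` turns the exponent into the integral of `1 - (1 + s l(√x))⁻¹` over `x > d₀²`. On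
band `i` the integrand is `(1 + x^{αᵢ/2} / (s Kᵢ))⁻¹`, and Euler's integral identifies its primitive
at `b²` as `b² ω₂` (`sq_mul_omega2`). Summing over bands gives `exponentTerm_eq_integral`. For one
slope the exponent collapses to `d₀² δ`, and the average over `r₀` is elementary.

Sums and exponentials live in `[0, ∞]` with `nexp ⊤ = 0`, so infinite interference needs no separate
treatment. -/

noncomputable section

namespace CellNet

open scoped ENNReal

/-! ### The decreasing exponential on the extended nonnegative reals -/

/-- `exp (-x)` for `x ∈ [0, ∞]`, with value `0` at `∞`. -/
def nexp (x : ℝ≥0∞) : ℝ≥0∞ := EReal.exp (-(x : EReal))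

lemma continuous_nexp : Continuous nexp :=
  ENNReal.continuous_exp.comp (continuous_neg.comp continuous_coe_ennreal_ereal)

lemma measurable_nexp : Measurable nexp := continuous_nexp.measurable

lemma antitone_nexp : Antitone nexp := fun _ _ h =>
  EReal.exp_monotone (EReal.neg_le_neg_iff.2 (EReal.coe_ennreal_le_coe_ennreal_iff.2 h))

@[simp] lemma nexp_zero : nexp 0 = 1 := by simp [nexp]

@[simp] lemma nexp_top : nexp ⊤ = 0 := by simp [nexp]

lemma nexp_le_one (x : ℝ≥0∞) : nexp x ≤ 1 := nexp_zero ▸ antitone_nexp (zero_le)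

lemma nexp_ne_top (x : ℝ≥0∞) : nexp x ≠ ⊤ := ((nexp_le_one x).trans_lt ENNReal.one_lt_top).ne

lemma nexp_ofReal {x : ℝ} (hx : 0 ≤ x) :
    nexp (ENNReal.ofReal x) = ENNReal.ofReal (Real.exp (-x)) := by
  rw [nexp, EReal.coe_ennreal_ofReal, max_eq_left hx, ← EReal.coe_neg, EReal.exp_coe]

lemma nexp_eq_ofReal {x : ℝ≥0∞} (hx : x ≠ ⊤) :
    nexp x = ENNReal.ofReal (Real.exp (-x.toReal)) := by
  conv_lhs => rw [← ENNReal.ofReal_toReal hx]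
  exact nexp_ofReal ENNReal.toReal_nonneg

lemma nexp_ne_zero {x : ℝ≥0∞} (hx : x ≠ ⊤) : nexp x ≠ 0 := by
  rw [nexp_eq_ofReal hx]
  simpa using Real.exp_pos _

lemma nexp_add (x y : ℝ≥0∞) : nexp (x + y) = nexp x * nexp y := by
  rcases eq_or_ne x ⊤ with rfl | hx
  · simp
  rcases eq_or_ne y ⊤ with rfl | hy
  · simp
  rw [nexp_eq_ofReal hx, nexp_eq_ofReal hy, nexp_eq_ofReal (ENNReal.add_ne_top.2 ⟨hx, hy⟩),
    ← ENNReal.ofReal_mul (Real.exp_pos _).le, ← Real.exp_add, ENNReal.toReal_add hx hy, neg_add]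

lemma nexp_sum {ι : Type*} (s : Finset ι) (f : ι → ℝ≥0∞) :
    nexp (∑ i ∈ s, f i) = ∏ i ∈ s, nexp (f i) := by
  classical
  induction s using Finset.induction_on with
  | empty => simp
  | insert a s ha ih => rw [Finset.sum_insert ha, Finset.prod_insert ha, nexp_add, ih]

lemma nexp_mul_natCast (x : ℝ≥0∞) (k : ℕ) : nexp (x * k) = nexp x ^ k := by
  induction k with
  | zero => simp
  | succ k ih => rw [Nat.cast_succ, mul_add, mul_one, nexp_add, ih, pow_succ]

/-- `log (1 + x)` for `x ∈ [0, ∞]`. -/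
def logOneAdd (x : ℝ≥0∞) : ℝ≥0∞ := (ENNReal.log (1 + x)).toENNReal

lemma continuous_logOneAdd : Continuous logOneAdd :=
  EReal.continuous_toENNReal.comp (ENNReal.continuous_log.comp (by fun_prop))

lemma measurable_logOneAdd : Measurable logOneAdd := continuous_logOneAdd.measurable

lemma monotone_logOneAdd : Monotone logOneAdd := fun _ _ h =>
  EReal.toENNReal_le_toENNReal (ENNReal.log_monotone (by gcongr))

lemma nexp_logOneAdd (x : ℝ≥0∞) : nexp (logOneAdd x) = (1 + x)⁻¹ := by
  have h : (0 : EReal) ≤ ENNReal.log (1 + x) := by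
    rw [← ENNReal.log_one]
    exact ENNReal.log_monotone le_self_add
  rw [nexp, logOneAdd, EReal.coe_toENNReal h, EReal.exp_neg, ENNReal.exp_log]

lemma logOneAdd_ne_top {x : ℝ≥0∞} (hx : x ≠ ⊤) : logOneAdd x ≠ ⊤ := by
  intro h
  have := nexp_logOneAdd x
  rw [h, nexp_top, eq_comm, ENNReal.inv_eq_zero] at this
  exact ENNReal.add_ne_top.2 ⟨ENNReal.one_ne_top, hx⟩ this

/-! ### Laplace functional of a Poisson point process -/

section Poisson

variable {Ω E : Type*}

lemma coe_pointCount (X : ℕ → Ω → E) (A : Set E) (ω : Ω) :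
    (pointCount X A ω : ℝ≥0∞) = ∑' i, A.indicator (fun _ => 1) (X i ω) := by
  rw [pointCount, ← ENNReal.tsum_set_one, tsum_subtype {i | X i ω ∈ A} (fun _ => (1 : ℝ≥0∞))]
  rfl

/-- Grouping the points by the value of `f` reduces the sum to finitely many point counts, the only
quantities whose law is given. -/
lemma tsum_simpleFunc_comp [MeasurableSpace E] (f : SimpleFunc E ℝ≥0∞) (X : ℕ → Ω → E) (ω : Ω) :
    ∑' i, f (X i ω) = ∑ c ∈ f.range, c * pointCount X (f ⁻¹' {c}) ω := by
  simp_rw [coe_pointCount, ← ENNReal.tsum_mul_left]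
  rw [← Summable.tsum_finsetSum (fun _ _ => ENNReal.summable)]
  refine tsum_congr fun i => ?_
  rw [Finset.sum_eq_single (f (X i ω))]
  · simp
  · intro c _ hc
    rw [Set.indicator_of_notMem, mul_zero]
    simpa using hc.symm
  · intro h
    exact absurd (f.mem_range_self _) h

variable [MeasurableSpace Ω] [MeasurableSpace E]

lemma measurable_pointCount {X : ℕ → Ω → E} (hX : ∀ i, Measurable (X i)) {A : Set E}
    (hA : MeasurableSet A) : Measurable (pointCount X A) := by
  have h : Measurable fun ω => (pointCount X A ω : ℝ≥0∞) := by
    simp_rw [coe_pointCount]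
    exact Measurable.tsum fun i => (measurable_const.indicator hA).comp (hX i)
  refine measurable_to_countable' fun k => ?_
  have : pointCount X A ⁻¹' {k} = (fun ω => (pointCount X A ω : ℝ≥0∞)) ⁻¹' {(k : ℝ≥0∞)} := by
    ext ω; simp
  rw [this]
  exact h (measurableSet_singleton _)

lemma IsPoissonPointProcess.map {F : Type*} [MeasurableSpace F] {μ : Measure Ω} {X : ℕ → Ω → E}
    {ν : Measure E} (hX : IsPoissonPointProcess μ X ν) {f : E → F} (hf : Measurable f) :
    IsPoissonPointProcess μ (fun i ω => f (X i ω)) (ν.map f) where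
  measurable i := hf.comp (hX.measurable i)
  count_law A hA hν k := by
    rw [Measure.map_apply hf hA] at hν ⊢
    exact hX.count_law _ (hf hA) hν k
  indep m A hA hd := hX.indep m (fun j => f ⁻¹' A j) (fun j => hf (hA j))
    fun _ _ hij => (hd hij).preimage f

lemma tsum_poisson_mul_pow (a : NNReal) (q : ℝ) (hq : 0 ≤ q) :
    ∑' k : ℕ, ENNReal.ofReal q ^ k * poissonMeasure a {k}
      = ENNReal.ofReal (Real.exp (-((1 - q) * a))) := by
  have h : HasSum (fun k : ℕ => Real.exp (-a) * ((q * a) ^ k / k.factorial))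
      (Real.exp (-a) * Real.exp (q * a)) := by
    refine HasSum.mul_left _ ?_
    rw [Real.exp_eq_exp_ℝ]
    exact NormedSpace.expSeries_div_hasSum_exp _
  have h2 : ∀ k : ℕ, ENNReal.ofReal q ^ k * poissonMeasure a {k}
      = ENNReal.ofReal (Real.exp (-a) * ((q * a) ^ k / k.factorial)) := by
    intro k
    rw [poissonMeasure_singleton, ← ENNReal.ofReal_pow hq, ← ENNReal.ofReal_mul (by positivity)]
    congr 1
    rw [mul_pow]; ring
  simp_rw [h2]
  rw [← ENNReal.ofReal_tsum_of_nonneg (fun k => by positivity) h.summable, h.tsum_eq,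
    ← Real.exp_add]
  congr 2; ring

/-- This is the Poisson generating function at `e^{-c}`. With `c ≠ 0` an infinite count contributes
nothing, so its probability never has to be computed. -/
lemma IsPoissonPointProcess.lintegral_nexp_mul_pointCount {μ : Measure Ω} {X : ℕ → Ω → E}
    {ν : Measure E} (hX : IsPoissonPointProcess μ X ν) {A : Set E} (hA : MeasurableSet A)
    (hν : ν A ≠ ⊤) {c : ℝ≥0∞} (hc : c ≠ 0) :
    ∫⁻ ω, nexp (c * pointCount X A ω) ∂μ = nexp ((1 - nexp c) * ν A) := by
  have hm := measurable_pointCount hX.measurable hA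
  have h1 : ∫⁻ ω, nexp (c * pointCount X A ω) ∂μ
      = ∫⁻ k : ℕ∞, nexp (c * k) ∂(μ.map (pointCount X A)) :=
    (lintegral_map (f := fun k : ℕ∞ => nexp (c * k)) (Measurable.of_discrete) hm).symm
  rw [h1, lintegral_countable']
  have hinj : Function.Injective (Nat.cast : ℕ → ℕ∞) := Nat.cast_injective
  -- The summand at `⊤` vanishes, which leaves a sum over `ℕ`.
  rw [← hinj.tsum_eq]
  · have h2 : ∀ k : ℕ, nexp (c * ((k : ℕ∞) : ℝ≥0∞)) * (μ.map (pointCount X A)) {(k : ℕ∞)}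
        = ENNReal.ofReal (nexp c).toReal ^ k * poissonMeasure (ν A).toNNReal {k} := by
      intro k
      rw [Measure.map_apply hm (MeasurableSet.of_discrete),
        ← hX.count_law A hA hν.lt_top k, ENNReal.ofReal_toReal (nexp_ne_top c),
        ← nexp_mul_natCast, ENat.toENNReal_coe]
      rfl
    simp_rw [h2]
    rw [tsum_poisson_mul_pow _ _ ENNReal.toReal_nonneg]
    have hle : (nexp c).toReal ≤ 1 := ENNReal.toReal_le_of_le_ofReal zero_le_one (by
      simpa using nexp_le_one c)
    rw [nexp_eq_ofReal (ENNReal.mul_ne_top (by simp) hν), ENNReal.toReal_mul,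
      ENNReal.toReal_sub_of_le (nexp_le_one c) ENNReal.one_ne_top]
    rfl
  · intro k hk
    induction k using ENat.recTopCoe with
    | top => simp [ENNReal.mul_top hc] at hk
    | coe n => exact ⟨n, rfl⟩

lemma IsPoissonPointProcess.iIndepFun_pointCount {μ : Measure Ω} {X : ℕ → Ω → E}
    {ν : Measure E} (hX : IsPoissonPointProcess μ X ν) {ι : Type*} [Fintype ι] {A : ι → Set E}
    (hA : ∀ i, MeasurableSet (A i)) (hd : Pairwise (fun i j => Disjoint (A i) (A j))) :
    iIndepFun (fun i ω => pointCount X (A i) ω) μ := by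
  let e := Fintype.equivFin ι
  have h := hX.indep (Fintype.card ι) (fun j => A (e.symm j)) (fun j => hA _)
    (fun i j hij => hd (e.symm.injective.ne hij))
  have := h.precomp e.injective
  simpa [Function.comp_def] using this

/-- The level sets of `f` are disjoint, so their counts are independent and the expectation factors
over the values of `f`. The value `0` contributes `1` on both sides, so its level set may have
infinite measure. -/
lemma IsPoissonPointProcess.lintegral_nexp_tsum_simpleFunc {μ : Measure Ω} {X : ℕ → Ω → E}
    {ν : Measure E} [IsProbabilityMeasure μ] (hX : IsPoissonPointProcess μ X ν)
    (f : SimpleFunc E ℝ≥0∞) (hf : ∀ c ≠ 0, ν (f ⁻¹' {c}) ≠ ⊤) :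
    ∫⁻ ω, nexp (∑' i, f (X i ω)) ∂μ = nexp (∫⁻ x, (1 - nexp (f x)) ∂ν) := by
  have hind : iIndepFun (fun (c : f.range) ω => pointCount X (f ⁻¹' {(c : ℝ≥0∞)}) ω) μ := by
    refine hX.iIndepFun_pointCount (fun c => f.measurableSet_preimage _) fun c d hcd => ?_
    exact Disjoint.preimage _ (Set.disjoint_singleton.2 fun h => hcd (Subtype.ext h))
  have hind' := hind.comp (fun (c : f.range) (k : ℕ∞) => nexp (c * k))
    (fun _ => Measurable.of_discrete)
  simp_rw [tsum_simpleFunc_comp, nexp_sum]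
  have h1 : ∀ ω, ∏ c ∈ f.range, nexp (c * pointCount X (f ⁻¹' {c}) ω)
      = ∏ c : f.range, nexp (c * pointCount X (f ⁻¹' {(c : ℝ≥0∞)}) ω) := fun ω =>
    (Finset.prod_coe_sort f.range fun c => nexp (c * pointCount X (f ⁻¹' {c}) ω)).symm
  simp_rw [h1]
  have h3 := lintegral_prod_eq_prod_lintegral_of_indepFun Finset.univ _ hind' fun c =>
    Measurable.of_discrete.comp (measurable_pointCount hX.measurable (f.measurableSet_preimage _))
  simp only [Function.comp_apply] at h3
  rw [h3]
  have h2 : ∫⁻ x, (1 - nexp (f x)) ∂ν = ∑ c ∈ f.range, (1 - nexp c) * ν (f ⁻¹' {c}) := by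
    rw [← SimpleFunc.map_lintegral (fun c => 1 - nexp c) f, ← SimpleFunc.lintegral_eq_lintegral]
    rfl
  rw [h2, nexp_sum, ← Finset.prod_coe_sort f.range]
  refine Finset.prod_congr rfl fun c _ => ?_
  rcases eq_or_ne (c : ℝ≥0∞) 0 with hc | hc
  · simp [hc]
  · exact hX.lintegral_nexp_mul_pointCount (f.measurableSet_preimage _) (hf c hc) hc

/-- Simple functions increasing to `h`, cut off to sets of finite measure, satisfy the identity. The
left side passes to the limit by domination by `1`, the right side by monotone convergence. -/
theorem IsPoissonPointProcess.lintegral_nexp_tsum {μ : Measure Ω} {X : ℕ → Ω → E}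
    {ν : Measure E} [IsProbabilityMeasure μ] [SigmaFinite ν] (hX : IsPoissonPointProcess μ X ν)
    {h : E → ℝ≥0∞} (hh : Measurable h) :
    ∫⁻ ω, nexp (∑' i, h (X i ω)) ∂μ = nexp (∫⁻ x, (1 - nexp (h x)) ∂ν) := by
  let S := spanningSets ν
  let f : ℕ → SimpleFunc E ℝ≥0∞ := fun k => (SimpleFunc.eapprox h k).restrict (S k)
  have hS : ∀ k, MeasurableSet (S k) := measurableSet_spanningSets ν
  have hfm : ∀ x, Monotone fun k => f k x := by
    intro x j k hjk
    simp only [f, SimpleFunc.restrict_apply _ (hS _)]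
    refine (Set.indicator_le_indicator_of_subset (monotone_spanningSets ν hjk)
      (fun _ => zero_le) x).trans (Set.indicator_le_indicator ?_)
    exact SimpleFunc.monotone_eapprox h hjk x
  have hft : ∀ x, Tendsto (fun k => f k x) atTop (𝓝 (h x)) := by
    intro x
    refine (SimpleFunc.tendsto_eapprox hh x).congr' ?_
    filter_upwards [eventually_ge_atTop (spanningSetsIndex ν x)] with k hk
    simp only [f, SimpleFunc.restrict_apply _ (hS _)]
    rw [Set.indicator_of_mem]
    exact monotone_spanningSets ν hk (mem_spanningSetsIndex ν x)
  have hkey : ∀ k, ∫⁻ ω, nexp (∑' i, f k (X i ω)) ∂μ = nexp (∫⁻ x, (1 - nexp (f k x)) ∂ν) := by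
    intro k
    refine hX.lintegral_nexp_tsum_simpleFunc (f k) fun c hc => ?_
    refine ((measure_mono ?_).trans_lt (measure_spanningSets_lt_top ν k)).ne
    intro x hx
    by_contra hxS
    simp only [f, SimpleFunc.restrict_apply _ (hS _), Set.mem_preimage, Set.mem_singleton_iff] at hx
    rw [Set.indicator_of_notMem hxS] at hx
    exact hc hx.symm
  have hL : Tendsto (fun k => ∫⁻ ω, nexp (∑' i, f k (X i ω)) ∂μ) atTop
      (𝓝 (∫⁻ ω, nexp (∑' i, h (X i ω)) ∂μ)) := by
    refine tendsto_lintegral_of_dominated_convergence (fun _ => 1) (fun k => ?_)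
      (fun k => ae_of_all _ fun ω => nexp_le_one _) (by simp) (ae_of_all _ fun ω => ?_)
    · exact measurable_nexp.comp
        (Measurable.tsum fun i => (f k).measurable.comp (hX.measurable i))
    · refine (continuous_nexp.tendsto _).comp ?_
      simp_rw [← lintegral_count]
      exact lintegral_tendsto_of_tendsto_of_monotone (fun _ => Measurable.of_discrete.aemeasurable)
        (ae_of_all _ fun i => hfm _) (ae_of_all _ fun i => hft _)
  have hR : Tendsto (fun k => nexp (∫⁻ x, (1 - nexp (f k x)) ∂ν)) atTop
      (𝓝 (nexp (∫⁻ x, (1 - nexp (h x)) ∂ν))) := by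
    refine (continuous_nexp.tendsto _).comp ?_
    refine lintegral_tendsto_of_tendsto_of_monotone
      (fun k => (measurable_const.sub (measurable_nexp.comp (f k).measurable)).aemeasurable)
      (ae_of_all _ fun x j k hjk => ?_) (ae_of_all _ fun x => ?_)
    · exact tsub_le_tsub_left (antitone_nexp (hfm x hjk)) 1
    · exact ENNReal.Tendsto.sub tendsto_const_nhds ((continuous_nexp.tendsto _).comp (hft x))
        (Or.inl ENNReal.one_ne_top)
  simp_rw [hkey] at hL
  exact tendsto_nhds_unique hL hR

end Poisson

/-! ### A survival function with locally bounded hazard rate -/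

/-- The rate `p` is only measurable, so the fundamental theorem of calculus is used in its
absolutely continuous form: `G` is Lipschitz because `0 ≤ p ≤ 1`, and its derivative is `p` almost
everywhere by Lebesgue differentiation. -/
lemma integral_hazard_mul_exp {p : ℝ → ℝ} (hp : Measurable p) (h0 : ∀ x, 0 ≤ p x)
    (h1 : ∀ x, p x ≤ 1) (κ C : ℝ) {a b : ℝ} (ha : 0 ≤ a) (hab : a ≤ b) :
    ∫ v in a..b, κ * p v * Real.exp (-(κ * (C + ∫ w in 0..v, p w)))
      = Real.exp (-(κ * (C + ∫ w in 0..a, p w))) - Real.exp (-(κ * (C + ∫ w in 0..b, p w))) := by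
  have hloc : LocallyIntegrable p volume := by
    refine (locallyIntegrable_const (1 : ℝ)).mono hp.aestronglyMeasurable (ae_of_all _ fun x => ?_)
    simpa [abs_of_nonneg (h0 x)] using h1 x
  have hint : ∀ x y, IntervalIntegrable p volume x y := fun x y =>
    intervalIntegrable_iff.2 ((hloc.integrableOn_isCompact isCompact_uIcc).mono_set
      Set.uIoc_subset_uIcc)
  set G : ℝ → ℝ := fun v => ∫ w in 0..v, p w with hG
  have hGlip : LipschitzWith 1 G := by
    refine LipschitzWith.of_dist_le_mul fun x y => ?_
    rw [Real.dist_eq, Real.dist_eq, hG]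
    simp only
    rw [intervalIntegral.integral_interval_sub_left (hint _ _) (hint _ _), ← Real.norm_eq_abs]
    have := intervalIntegral.norm_integral_le_of_norm_le_const (a := y) (b := x) (f := p) (C := 1)
      (fun t _ => by simpa [abs_of_nonneg (h0 t)] using h1 t)
    simpa using this
  let e : ℝ → ℝ := fun y => Real.exp (-(κ * (C + y)))
  -- The exponential is Lipschitz only on bounded sets, so the range of `G` has to be confined to a
  -- compact interval.
  have hmaps : Set.MapsTo G (Set.uIcc a b) (Set.Icc 0 b) := by
    intro x hx
    rw [Set.uIcc_of_le hab] at hx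
    have hx0 : 0 ≤ x := ha.trans hx.1
    refine ⟨intervalIntegral.integral_nonneg hx0 fun t _ => h0 t, ?_⟩
    refine le_trans ?_ hx.2
    calc G x ≤ ∫ _ in (0 : ℝ)..x, (1 : ℝ) :=
          intervalIntegral.integral_mono_on hx0 (hint _ _) (by simp) fun t _ => h1 t
      _ = x := by simp
  have he : ContDiff ℝ 1 e := by fun_prop
  obtain ⟨K, hK⟩ := he.contDiffOn.exists_lipschitzOnWith (s := Set.Icc 0 b) (by decide)
    (convex_Icc _ _) isCompact_Icc
  have hac : AbsolutelyContinuousOnInterval (e ∘ G) a b :=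
    (hK.comp hGlip.lipschitzOnWith hmaps).absolutelyContinuousOnInterval
  have hftc := hac.integral_deriv_eq_sub
  have hder : ∀ᵐ v, deriv (e ∘ G) v = -(κ * p v * Real.exp (-(κ * (C + G v)))) := by
    filter_upwards [LocallyIntegrable.ae_hasDerivAt_integral hloc] with v hv
    have h2 : HasDerivAt (fun y : ℝ => -(κ * (C + G y))) (-(κ * p v)) v :=
      (((hv 0).const_add C).const_mul κ).neg
    have := h2.exp.deriv
    rw [show e ∘ G = fun y => Real.exp (-(κ * (C + G y))) from rfl, this]
    ring
  rw [intervalIntegral.integral_congr_ae (hder.mono fun v hv _ => hv),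
    intervalIntegral.integral_neg] at hftc
  simp only [Function.comp, e, hG] at hftc ⊢
  linarith

/-- The function of `a` on the right is a survival function: `a + ∫_a^∞ (1 - φ)` has derivative `φ`
almost everywhere and tends to infinity, so integrating the density `κ φ exp(-κ …)` from `a`
recovers the whole tail. -/
lemma lintegral_Ici_hazard {φ : ℝ → ℝ≥0∞} (hφ : Measurable φ) (h1 : ∀ x, φ x ≤ 1) {κ : ℝ}
    (hκ : 0 < κ) (hfin : ∫⁻ w in Set.Ici 0, (1 - φ w) ≠ ⊤) {a : ℝ} (ha : 0 ≤ a) :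
    ∫⁻ v in Set.Ici a, ENNReal.ofReal κ * φ v *
        nexp (ENNReal.ofReal κ * (ENNReal.ofReal v + ∫⁻ w in Set.Ici v, (1 - φ w)))
      = nexp (ENNReal.ofReal κ * (ENNReal.ofReal a + ∫⁻ w in Set.Ici a, (1 - φ w))) := by
  have hφt : ∀ x, φ x ≠ ⊤ := fun x => ((h1 x).trans_lt ENNReal.one_lt_top).ne
  set p : ℝ → ℝ := fun x => (φ x).toReal with hpdef
  have hp : Measurable p := hφ.ennreal_toReal
  have hp0 : ∀ x, 0 ≤ p x := fun x => ENNReal.toReal_nonneg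
  have hp1 : ∀ x, p x ≤ 1 := fun x => ENNReal.toReal_le_of_le_ofReal zero_le_one (by simpa using h1 x)
  have hof : ∀ x, ENNReal.ofReal (1 - p x) = 1 - φ x := fun x => by
    rw [ENNReal.ofReal_sub _ (hp0 x), ENNReal.ofReal_one, ENNReal.ofReal_toReal (hφt x)]
  have hi : IntegrableOn (fun w => 1 - p w) (Set.Ioi 0) := by
    rw [← integrableOn_Ici_iff_integrableOn_Ioi]
    refine ⟨(measurable_const.sub hp).aestronglyMeasurable, ?_⟩
    rw [hasFiniteIntegral_iff_ofReal (ae_of_all _ fun x => sub_nonneg.2 (hp1 x))]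
    simp_rw [hof]
    exact hfin.lt_top
  set C : ℝ := ∫ w in Set.Ioi 0, (1 - p w) with hC
  set G : ℝ → ℝ := fun v => ∫ w in 0..v, p w with hG
  have hint : ∀ x y, IntervalIntegrable p volume x y := fun x y => by
    refine (intervalIntegrable_const (c := (1 : ℝ))).mono_fun hp.aestronglyMeasurable
      (ae_of_all _ fun x => ?_)
    simpa [abs_of_nonneg (hp0 x)] using hp1 x
  -- With `C = ∫_0^∞ (1 - p)`, the identity `v + ∫_v^∞ (1 - p) = C + ∫_0^v p` moves the dependence
  -- on `v` to the upper limit of an integral of `p`.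
  have hS : ∀ v, 0 ≤ v → ENNReal.ofReal v + ∫⁻ w in Set.Ici v, (1 - φ w)
      = ENNReal.ofReal (C + G v) := by
    intro v hv
    have hiv : IntegrableOn (fun w => 1 - p w) (Set.Ioi v) := hi.mono_set (Set.Ioi_subset_Ioi hv)
    have h3 : ∫⁻ w in Set.Ici v, (1 - φ w) = ENNReal.ofReal (∫ w in Set.Ioi v, (1 - p w)) := by
      rw [ofReal_integral_eq_lintegral_ofReal hiv (ae_of_all _ fun x => sub_nonneg.2 (hp1 x)),
        setLIntegral_congr Ioi_ae_eq_Ici]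
      simp_rw [hof]
    rw [h3, ← ENNReal.ofReal_add hv (integral_nonneg fun x => sub_nonneg.2 (hp1 x))]
    congr 1
    have h4 := intervalIntegral.integral_Ioi_sub_Ioi hi hv
    rw [intervalIntegral.integral_sub (by simp) (hint _ _)] at h4
    simp only [intervalIntegral.integral_const, sub_zero, smul_eq_mul, mul_one] at h4
    simp only [hC, hG]
    linarith
  have hS0 : ∀ v, 0 ≤ v → 0 ≤ C + G v := fun v hv =>
    add_nonneg (integral_nonneg fun x => sub_nonneg.2 (hp1 x))
      (intervalIntegral.integral_nonneg hv fun t _ => hp0 t)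
  have hnexp : ∀ v, 0 ≤ v → nexp (ENNReal.ofReal κ * (ENNReal.ofReal v +
      ∫⁻ w in Set.Ici v, (1 - φ w))) = ENNReal.ofReal (Real.exp (-(κ * (C + G v)))) := by
    intro v hv
    rw [hS v hv, ← ENNReal.ofReal_mul hκ.le, nexp_ofReal (mul_nonneg hκ.le (hS0 v hv))]
  have hGm : Continuous G := intervalIntegral.continuous_primitive hint 0
  rw [hnexp a ha]
  have hcongr : ∫⁻ v in Set.Ici a, ENNReal.ofReal κ * φ v *
        nexp (ENNReal.ofReal κ * (ENNReal.ofReal v + ∫⁻ w in Set.Ici v, (1 - φ w)))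
      = ∫⁻ v in Set.Ioi a, ENNReal.ofReal (κ * p v * Real.exp (-(κ * (C + G v)))) := by
    rw [setLIntegral_congr Ioi_ae_eq_Ici.symm]
    refine setLIntegral_congr_fun measurableSet_Ioi fun v hv => ?_
    rw [hnexp v (ha.trans (le_of_lt hv)), ENNReal.ofReal_mul (mul_nonneg hκ.le (hp0 v)),
      ENNReal.ofReal_mul hκ.le, ENNReal.ofReal_toReal (hφt v)]
  rw [hcongr]
  have hfm : Measurable fun v => κ * p v * Real.exp (-(κ * (C + G v))) := by
    have := hGm.measurable
    fun_prop
  have hcov : AECover (volume.restrict (Set.Ioi a)) atTop fun b : ℝ => Set.Iic b :=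
    aecover_Iic tendsto_id
  refine hcov.lintegral_eq_of_tendsto _ hfm.ennreal_ofReal.aemeasurable ?_
  have hval : ∀ b, a ≤ b → ∫⁻ v in Set.Iic b, ENNReal.ofReal (κ * p v * Real.exp (-(κ * (C + G v))))
      ∂(volume.restrict (Set.Ioi a)) = ENNReal.ofReal
        (Real.exp (-(κ * (C + G a))) - Real.exp (-(κ * (C + G b)))) := by
    intro b hab
    rw [Measure.restrict_restrict measurableSet_Iic, Set.inter_comm, Set.Ioi_inter_Iic,
      ← integral_hazard_mul_exp hp hp0 hp1 κ C ha hab, intervalIntegral.integral_of_le hab,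
      ofReal_integral_eq_lintegral_ofReal]
    · refine (integrable_const κ).mono' hfm.aestronglyMeasurable ?_
      refine (ae_restrict_iff' measurableSet_Ioc).2 (ae_of_all _ fun v hv => ?_)
      have hv0 : 0 ≤ v := ha.trans hv.1.le
      rw [Real.norm_of_nonneg (mul_nonneg (mul_nonneg hκ.le (hp0 v)) (Real.exp_pos _).le), mul_assoc]
      refine mul_le_of_le_one_right hκ.le (mul_le_one₀ (hp1 v) (Real.exp_pos _).le ?_)
      exact Real.exp_le_one_iff.2 (neg_nonpos.2 (mul_nonneg hκ.le (hS0 v hv0)))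
    · exact ae_of_all _ fun v => mul_nonneg (mul_nonneg hκ.le (hp0 v)) (Real.exp_pos _).le
  refine Tendsto.congr' (f₁ := fun b => ENNReal.ofReal
    (Real.exp (-(κ * (C + G a))) - Real.exp (-(κ * (C + G b))))) ?_ ?_
  · filter_upwards [eventually_ge_atTop a] with b hb using (hval b hb).symm
  -- The bound `b ≤ C + G b` makes the survival function vanish at infinity.
  · have hCG : ∀ b, 0 ≤ b → b ≤ C + G b := by
      intro b hb
      have h5 := hS b hb
      have : ENNReal.ofReal b ≤ ENNReal.ofReal (C + G b) := h5 ▸ le_self_add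
      exact (ENNReal.ofReal_le_ofReal_iff (hS0 b hb)).1 this
    have hlim : Tendsto (fun b => κ * (C + G b)) atTop atTop :=
      (tendsto_atTop_mono' atTop ((eventually_ge_atTop 0).mono fun b hb => hCG b hb)
        tendsto_id).const_mul_atTop hκ
    have := (Real.tendsto_exp_neg_atTop_nhds_zero.comp hlim).const_sub (Real.exp (-(κ * (C + G a))))
    rw [sub_zero] at this
    exact (ENNReal.continuous_ofReal.tendsto _).comp this

/-! ### The nearest point of a homogeneous Poisson point process on the half-line -/

section Nearest

variable {Ω : Type*} [MeasurableSpace Ω] {μ : Measure Ω} [IsProbabilityMeasure μ]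
  {κ : ℝ} {ρ : ℕ → Ω → ℝ}

/-- Adding the weight `⊤` on `[0, a)` kills exactly the outcomes with a point below `a`. Since `ρ 0`
is the smallest point, these are the outcomes with `ρ 0 < a`, and the Laplace functional applies. -/
lemma setLIntegral_le_nearest
    (hρ : IsPoissonPointProcess μ ρ (ENNReal.ofReal κ • volume.restrict (Set.Ici 0)))
    (hmin : ∀ᵐ ω ∂μ, ∀ i, ρ 0 ω ≤ ρ i ω) {h : ℝ → ℝ≥0∞} (hh : Measurable h) {a : ℝ} (ha : 0 ≤ a) :
    ∫⁻ ω in {ω | a ≤ ρ 0 ω}, nexp (∑' i, h (ρ i ω)) ∂μ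
      = nexp (ENNReal.ofReal κ *
          (ENNReal.ofReal a + ∫⁻ w in Set.Ici a, (1 - nexp (h w)))) := by
  have hms : MeasurableSet {ω | a ≤ ρ 0 ω} := measurableSet_le measurable_const (hρ.measurable 0)
  have hh' : Measurable fun w => h w + (Set.Iio a).indicator (fun _ => ⊤) w :=
    hh.add (measurable_const.indicator measurableSet_Iio)
  have : SigmaFinite (ENNReal.ofReal κ • (volume : Measure ℝ).restrict (Set.Ici 0)) :=
    -- The scalar is the coercion of a finite one, for which multiples of σ-finite measures are
    -- known to be σ-finite.
    inferInstanceAs (SigmaFinite (κ.toNNReal • (volume : Measure ℝ).restrict (Set.Ici 0)))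
  have key := hρ.lintegral_nexp_tsum hh'
  have hL : ∫⁻ ω, nexp (∑' i, (h (ρ i ω) + (Set.Iio a).indicator (fun _ => ⊤) (ρ i ω))) ∂μ
      = ∫⁻ ω in {ω | a ≤ ρ 0 ω}, nexp (∑' i, h (ρ i ω)) ∂μ := by
    rw [← lintegral_indicator hms]
    refine lintegral_congr_ae ?_
    filter_upwards [hmin] with ω hω
    by_cases hω0 : a ≤ ρ 0 ω
    · rw [Set.indicator_of_mem (by exact hω0)]
      congr 1
      refine tsum_congr fun i => ?_
      rw [Set.indicator_of_notMem (by simpa using hω0.trans (hω i)), add_zero]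
    · rw [Set.indicator_of_notMem (by exact hω0), ENNReal.tsum_add,
        ENNReal.tsum_eq_top_of_eq_top (f := fun i => (Set.Iio a).indicator (fun _ => ⊤) (ρ i ω))
          ⟨0, Set.indicator_of_mem (s := Set.Iio a) (not_le.1 hω0) _⟩]
      simp
  rw [hL] at key
  rw [key, lintegral_smul_measure, smul_eq_mul]
  congr 2
  rw [← Set.Ico_union_Ici_eq_Ici ha, lintegral_union measurableSet_Ici
    (Set.disjoint_left.2 fun x hx hx' => not_le.2 hx.2 hx')]
  congr 1
  · rw [setLIntegral_congr_fun (g := fun _ => 1) measurableSet_Ico]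
    · simp
    · intro x hx
      simp [Set.indicator_of_mem (show x ∈ Set.Iio a from hx.2)]
  · refine setLIntegral_congr_fun measurableSet_Ici fun x hx => ?_
    have hx' : x ∉ Set.Iio a := fun h => not_lt.2 (Set.mem_Ici.1 hx) h
    simp only [Set.indicator_of_notMem hx', add_zero]

lemma measurable_lintegral_Ici {f : ℝ → ℝ≥0∞} :
    Measurable fun v : ℝ => ∫⁻ w in Set.Ici v, f w := by
  have : Antitone fun v : ℝ => ∫⁻ w in Set.Ici v, f w := fun _ _ h =>
    lintegral_mono_set (Set.Ici_subset_Ici.2 h)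
  exact this.measurable

/-- Both sides agree on every `[a, ∞)` with `a ≥ 0`, by the tail formula and `lintegral_Ici_hazard`.
Neither charges the negative half-line, and finite measures are determined by such rays. -/
lemma map_withDensity_nearest (hκ : 0 < κ)
    (hρ : IsPoissonPointProcess μ ρ (ENNReal.ofReal κ • volume.restrict (Set.Ici 0)))
    (hpos : ∀ ω, 0 ≤ ρ 0 ω)
    (hmin : ∀ᵐ ω ∂μ, ∀ i, ρ 0 ω ≤ ρ i ω) {h : ℝ → ℝ≥0∞} (hh : Measurable h)
    (hfin : ∫⁻ w in Set.Ici 0, (1 - nexp (h w)) ≠ ⊤) :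
    (μ.withDensity fun ω => nexp (∑' i, h (ρ i ω))).map (ρ 0)
      = (volume.restrict (Set.Ici 0)).withDensity fun v => ENNReal.ofReal κ * nexp (h v) *
        nexp (ENNReal.ofReal κ * (ENNReal.ofReal v + ∫⁻ w in Set.Ici v, (1 - nexp (h w)))) := by
  have hF : Measurable fun ω => nexp (∑' i, h (ρ i ω)) :=
    measurable_nexp.comp (Measurable.tsum fun i => hh.comp (hρ.measurable i))
  have hfinm : IsFiniteMeasure (μ.withDensity fun ω => nexp (∑' i, h (ρ i ω))) := by
    refine isFiniteMeasure_withDensity (ne_top_of_le_ne_top ENNReal.one_ne_top ?_)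
    calc ∫⁻ ω, nexp (∑' i, h (ρ i ω)) ∂μ ≤ ∫⁻ _, 1 ∂μ := lintegral_mono fun ω => nexp_le_one _
      _ = 1 := by simp
  have hnn : ∀ a, 0 ≤ a → (μ.withDensity fun ω => nexp (∑' i, h (ρ i ω))).map (ρ 0) (Set.Ici a)
      = (volume.restrict (Set.Ici 0)).withDensity (fun v => ENNReal.ofReal κ * nexp (h v) *
        nexp (ENNReal.ofReal κ * (ENNReal.ofReal v + ∫⁻ w in Set.Ici v, (1 - nexp (h w)))))
        (Set.Ici a) := by
    intro a ha
    have hms : MeasurableSet {ω | a ≤ ρ 0 ω} := measurableSet_le measurable_const (hρ.measurable 0)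
    rw [Measure.map_apply (hρ.measurable 0) measurableSet_Ici, withDensity_apply _ measurableSet_Ici,
      Measure.restrict_restrict measurableSet_Ici,
      Set.inter_eq_left.2 (Set.Ici_subset_Ici.2 ha),
      lintegral_Ici_hazard (φ := fun v => nexp (h v)) (measurable_nexp.comp hh)
        (fun x => nexp_le_one _) hκ hfin ha,
      ← setLIntegral_le_nearest hρ hmin hh ha, ← withDensity_apply _ hms]
    rfl
  refine Measure.ext_of_Ici _ _ fun a => ?_
  rcases le_total 0 a with ha | ha
  · exact hnn a ha
  · have h1 : (μ.withDensity fun ω => nexp (∑' i, h (ρ i ω))).map (ρ 0) (Set.Ici a)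
        = (μ.withDensity fun ω => nexp (∑' i, h (ρ i ω))).map (ρ 0) (Set.Ici 0) := by
      rw [Measure.map_apply (hρ.measurable 0) measurableSet_Ici,
        Measure.map_apply (hρ.measurable 0) measurableSet_Ici]
      congr 1
      ext ω
      simp [hpos ω, ha.trans (hpos ω)]
    rw [h1, hnn 0 le_rfl, withDensity_apply _ measurableSet_Ici,
      withDensity_apply _ measurableSet_Ici, Measure.restrict_restrict measurableSet_Ici,
      Measure.restrict_restrict measurableSet_Ici, Set.inter_self,
      Set.inter_eq_right.2 (Set.Ici_subset_Ici.2 ha)]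

lemma map_nearest (hκ : 0 < κ)
    (hρ : IsPoissonPointProcess μ ρ (ENNReal.ofReal κ • volume.restrict (Set.Ici 0)))
    (hpos : ∀ ω, 0 ≤ ρ 0 ω) (hmin : ∀ᵐ ω ∂μ, ∀ i, ρ 0 ω ≤ ρ i ω) :
    μ.map (ρ 0) = (volume.restrict (Set.Ici 0)).withDensity fun v =>
      ENNReal.ofReal κ * nexp (ENNReal.ofReal κ * ENNReal.ofReal v) := by
  have := map_withDensity_nearest hκ hρ hpos hmin (h := fun _ => 0) measurable_const (by simp)
  simpa using this

/-- Laplace functional of the points other than the nearest one, given the nearest one. -/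
lemma lintegral_mul_nexp_tsum_succ (hκ : 0 < κ)
    (hρ : IsPoissonPointProcess μ ρ (ENNReal.ofReal κ • volume.restrict (Set.Ici 0)))
    (hpos : ∀ ω, 0 ≤ ρ 0 ω) (hmin : ∀ᵐ ω ∂μ, ∀ i, ρ 0 ω ≤ ρ i ω)
    {h : ℝ → ℝ≥0∞} (hh : Measurable h) (htop : ∀ x, h x ≠ ⊤)
    (hfin : ∫⁻ w in Set.Ici 0, (1 - nexp (h w)) ≠ ⊤) {f : ℝ → ℝ≥0∞} (hf : Measurable f) :
    ∫⁻ ω, f (ρ 0 ω) * nexp (∑' i, h (ρ (i + 1) ω)) ∂μ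
      = ∫⁻ ω, f (ρ 0 ω) *
        nexp (ENNReal.ofReal κ * ∫⁻ w in Set.Ici (ρ 0 ω), (1 - nexp (h w))) ∂μ := by
  have hF : Measurable fun ω => nexp (∑' i, h (ρ i ω)) :=
    measurable_nexp.comp (Measurable.tsum fun i => hh.comp (hρ.measurable i))
  have hφ : Measurable fun v => nexp (h v) := measurable_nexp.comp hh
  have hJ : Measurable fun v : ℝ => ∫⁻ w in Set.Ici v, (1 - nexp (h w)) := measurable_lintegral_Ici
  have hnJ : Measurable fun v : ℝ => nexp (ENNReal.ofReal κ * ∫⁻ w in Set.Ici v, (1 - nexp (h w))) :=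
    measurable_nexp.comp (hJ.const_mul _)
  -- Dividing by `nexp (h v)` removes the contribution of the nearest point from the full sum; this
  -- is legitimate because `h` is finite.
  have hfφ : Measurable fun v => f v * (nexp (h v))⁻¹ := hf.mul hφ.inv
  have h1 : ∀ ω, f (ρ 0 ω) * nexp (∑' i, h (ρ (i + 1) ω))
      = nexp (∑' i, h (ρ i ω)) * (f (ρ 0 ω) * (nexp (h (ρ 0 ω)))⁻¹) := by
    intro ω
    have h0 : ∑' i, h (ρ i ω) = h (ρ 0 ω) + ∑' i, h (ρ (i + 1) ω) := tsum_eq_zero_add'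
      ENNReal.summable
    rw [h0, nexp_add]
    have := ENNReal.mul_inv_cancel (nexp_ne_zero (htop (ρ 0 ω))) (nexp_ne_top _)
    calc _ = (nexp (h (ρ 0 ω)) * (nexp (h (ρ 0 ω)))⁻¹) *
          (f (ρ 0 ω) * nexp (∑' i, h (ρ (i + 1) ω))) := by rw [this, one_mul]
      _ = _ := by ring
  simp_rw [h1]
  have h2 := lintegral_withDensity_eq_lintegral_mul μ hF (hfφ.comp (hρ.measurable 0))
  simp only [Pi.mul_apply, Function.comp_apply] at h2
  rw [← h2]
  have h3 := lintegral_map (μ := μ.withDensity fun ω => nexp (∑' i, h (ρ i ω))) hfφ (hρ.measurable 0)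
  rw [← h3, map_withDensity_nearest hκ hρ hpos hmin hh hfin]
  have h4 := lintegral_map (μ := μ) (hf.mul hnJ) (hρ.measurable 0)
  simp only [Pi.mul_apply] at h4
  rw [← h4, map_nearest hκ hρ hpos hmin]
  have hof : Measurable fun v : ℝ => ENNReal.ofReal v := ENNReal.measurable_ofReal
  rw [lintegral_withDensity_eq_lintegral_mul _ _ hfφ,
    lintegral_withDensity_eq_lintegral_mul _ _
      (g := fun v => f v * nexp (ENNReal.ofReal κ * ∫⁻ w in Set.Ici v, (1 - nexp (h w)))) (hf.mul hnJ)]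
  · refine lintegral_congr fun v => ?_
    simp only [Pi.mul_apply]
    rw [mul_add, nexp_add]
    have := ENNReal.mul_inv_cancel (nexp_ne_zero (htop v)) (nexp_ne_top _)
    calc _ = (nexp (h v) * (nexp (h v))⁻¹) * (ENNReal.ofReal κ *
          nexp (ENNReal.ofReal κ * ENNReal.ofReal v) *
          (f v * nexp (ENNReal.ofReal κ * ∫⁻ w in Set.Ici v, (1 - nexp (h w))))) := by ring
      _ = _ := by rw [this, one_mul]
  · exact measurable_const.mul (measurable_nexp.comp (hof.const_mul _))
  · exact (measurable_const.mul hφ).mul (measurable_nexp.comp ((hof.add hJ).const_mul _))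

end Nearest

/-! ### Weights that depend on the nearest point -/

/-- The integrand varies with `v` through `θ`, so monotonicity in `v` is lost and measurability
comes from the jointly measurable integrand. -/
lemma measurable_lintegral_Ici_mul {L θ : ℝ → ℝ≥0∞} (hL : Measurable L) (hθ : Measurable θ) :
    Measurable fun v : ℝ => ∫⁻ w in Set.Ici v, (1 - (1 + θ v * L w)⁻¹) := by
  have hm : Measurable fun x : ℝ × ℝ => (Set.Ici x.1).indicator
      (fun w => 1 - (1 + θ x.1 * L w)⁻¹) x.2 := by
    have hms : MeasurableSet {x : ℝ × ℝ | x.1 ≤ x.2} :=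
      measurableSet_le measurable_fst measurable_snd
    have hmf : Measurable fun x : ℝ × ℝ => 1 - (1 + θ x.1 * L x.2)⁻¹ :=
      measurable_const.sub (measurable_const.add
        ((hθ.comp measurable_fst).mul (hL.comp measurable_snd))).inv
    exact hmf.indicator hms
  have := hm.lintegral_prod_right' (ν := volume)
  simp_rw [lintegral_indicator measurableSet_Ici] at this
  exact this

section NearestParam

variable {Ω : Type*} [MeasurableSpace Ω] {μ : Measure Ω} [IsProbabilityMeasure μ]
  {κ : ℝ} {ρ : ℕ → Ω → ℝ}

lemma lintegral_nexp_tsum_succ_simpleFunc (hκ : 0 < κ)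
    (hρ : IsPoissonPointProcess μ ρ (ENNReal.ofReal κ • volume.restrict (Set.Ici 0)))
    (hpos : ∀ ω, 0 ≤ ρ 0 ω) (hmin : ∀ᵐ ω ∂μ, ∀ i, ρ 0 ω ≤ ρ i ω)
    {L : ℝ → ℝ≥0∞} (hL : Measurable L) (hLtop : ∀ x, L x ≠ ⊤)
    (hLint : ∫⁻ w in Set.Ici 0, L w ≠ ⊤) (θ : SimpleFunc ℝ ℝ≥0∞) (hθ : ∀ x, θ x ≠ ⊤) :
    ∫⁻ ω, nexp (∑' i, logOneAdd (θ (ρ 0 ω) * L (ρ (i + 1) ω))) ∂μ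
      = ∫⁻ ω, nexp (ENNReal.ofReal κ *
          ∫⁻ w in Set.Ici (ρ 0 ω), (1 - (1 + θ (ρ 0 ω) * L w)⁻¹)) ∂μ := by
  -- On each level set of `θ` the weight no longer depends on `ρ 0`, so the result for a fixed
  -- weight applies there, with the indicator of the level set as `f`.
  have hsplit : ∀ F : ℝ≥0∞ → Ω → ℝ≥0∞, (∀ c, Measurable (F c)) →
      ∫⁻ ω, F (θ (ρ 0 ω)) ω ∂μ = ∑ c ∈ θ.range,
        ∫⁻ ω, (θ ⁻¹' {c}).indicator (fun _ => 1) (ρ 0 ω) * F c ω ∂μ := by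
    intro F hF
    rw [← lintegral_finsetSum]
    · refine lintegral_congr fun ω => ?_
      rw [Finset.sum_eq_single (θ (ρ 0 ω))]
      · simp
      · intro c _ hc
        rw [Set.indicator_of_notMem, zero_mul]
        simpa using hc.symm
      · intro h
        exact absurd (θ.mem_range_self _) h
    · intro c _
      exact ((measurable_const.indicator (θ.measurableSet_preimage _)).comp
        (hρ.measurable 0)).mul (hF c)
  rw [hsplit (fun c ω => nexp (∑' i, logOneAdd (c * L (ρ (i + 1) ω)))) fun c =>
      measurable_nexp.comp (Measurable.tsum fun i =>
        measurable_logOneAdd.comp ((hL.comp (hρ.measurable _)).const_mul c)),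
    hsplit (fun c ω => nexp (ENNReal.ofReal κ *
      ∫⁻ w in Set.Ici (ρ 0 ω), (1 - (1 + c * L w)⁻¹))) fun c =>
      measurable_nexp.comp ((measurable_lintegral_Ici.comp (hρ.measurable 0)).const_mul _)]
  refine Finset.sum_congr rfl fun c hc => ?_
  obtain ⟨x, rfl⟩ := SimpleFunc.mem_range.1 hc
  have := lintegral_mul_nexp_tsum_succ hκ hρ hpos hmin (h := fun w => logOneAdd (θ x * L w))
    (measurable_logOneAdd.comp (hL.const_mul _))
    (fun w => logOneAdd_ne_top (ENNReal.mul_ne_top (hθ x) (hLtop w))) ?_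
    (f := (θ ⁻¹' {θ x}).indicator fun _ => 1)
    (measurable_const.indicator (θ.measurableSet_preimage _))
  · simpa only [nexp_logOneAdd] using this
  -- Finiteness follows from `1 - (1 + x)⁻¹ ≤ x` and the integrability of `L`.
  · refine ne_top_of_le_ne_top (ENNReal.mul_ne_top (hθ x) hLint) ?_
    rw [← lintegral_const_mul _ hL]
    refine lintegral_mono fun w => ?_
    rw [nexp_logOneAdd, tsub_le_iff_right]
    have hne : 1 + θ x * L w ≠ 0 := by simp
    have hnt : 1 + θ x * L w ≠ ⊤ :=
      ENNReal.add_ne_top.2 ⟨ENNReal.one_ne_top, ENNReal.mul_ne_top (hθ x) (hLtop w)⟩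
    have h1 : 1 ≤ (1 + θ x * L w) * (1 + θ x * L w) := one_le_mul le_self_add le_self_add
    calc (1 : ℝ≥0∞) = (1 + θ x * L w) * (1 + θ x * L w)⁻¹ := (ENNReal.mul_inv_cancel hne hnt).symm
      _ = θ x * L w * (1 + θ x * L w)⁻¹ + (1 + θ x * L w)⁻¹ := by ring
      _ ≤ θ x * L w * 1 + (1 + θ x * L w)⁻¹ := by
        gcongr
        exact ENNReal.inv_le_one.2 le_self_add
      _ = _ := by rw [mul_one]

lemma tendsto_mul_eapprox {θ : ℝ → ℝ≥0∞} (hθ : Measurable θ) (v : ℝ) {c : ℝ≥0∞} (hc : c ≠ ⊤) :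
    Tendsto (fun k => SimpleFunc.eapprox θ k v * c) atTop (𝓝 (θ v * c)) :=
  ENNReal.Tendsto.mul_const (SimpleFunc.tendsto_eapprox hθ v) (Or.inr hc)

/-- For a homogeneous Poisson point process on the half-line with nearest point `ρ 0`, the mean of
`∏ (1 + θ (ρ 0) L (ρ i))⁻¹` over the other points, in terms of the law of `ρ 0`. -/
theorem lintegral_nexp_tsum_nearest (hκ : 0 < κ)
    (hρ : IsPoissonPointProcess μ ρ (ENNReal.ofReal κ • volume.restrict (Set.Ici 0)))
    (hpos : ∀ ω, 0 ≤ ρ 0 ω) (hmin : ∀ᵐ ω ∂μ, ∀ i, ρ 0 ω ≤ ρ i ω)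
    {L θ : ℝ → ℝ≥0∞} (hL : Measurable L) (hLtop : ∀ x, L x ≠ ⊤)
    (hLint : ∫⁻ w in Set.Ici 0, L w ≠ ⊤) (hθ : Measurable θ) :
    ∫⁻ ω, nexp (∑' i, logOneAdd (θ (ρ 0 ω) * L (ρ (i + 1) ω))) ∂μ
      = ∫⁻ ω, nexp (ENNReal.ofReal κ *
          ∫⁻ w in Set.Ici (ρ 0 ω), (1 - (1 + θ (ρ 0 ω) * L w)⁻¹)) ∂μ := by
  let e := SimpleFunc.eapprox θ
  have hkey := fun k => lintegral_nexp_tsum_succ_simpleFunc hκ hρ hpos hmin hL hLtop hLint (e k)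
    (fun x => (SimpleFunc.eapprox_lt_top θ k x).ne)
  have hmono : ∀ v, Monotone fun k => e k v := fun v j k hjk => SimpleFunc.monotone_eapprox θ hjk v
  have hA : Tendsto (fun k => ∫⁻ ω, nexp (∑' i, logOneAdd (e k (ρ 0 ω) * L (ρ (i + 1) ω))) ∂μ) atTop
      (𝓝 (∫⁻ ω, nexp (∑' i, logOneAdd (θ (ρ 0 ω) * L (ρ (i + 1) ω))) ∂μ)) := by
    refine tendsto_lintegral_of_dominated_convergence (fun _ => 1) (fun k => ?_)
      (fun k => ae_of_all _ fun ω => nexp_le_one _) (by simp) (ae_of_all _ fun ω => ?_)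
    · exact measurable_nexp.comp (Measurable.tsum fun i => measurable_logOneAdd.comp
        (((e k).measurable.comp (hρ.measurable 0)).mul (hL.comp (hρ.measurable _))))
    · refine (continuous_nexp.tendsto _).comp ?_
      simp_rw [← lintegral_count]
      refine lintegral_tendsto_of_tendsto_of_monotone
        (fun _ => Measurable.of_discrete.aemeasurable) (ae_of_all _ fun i j k hjk => ?_)
        (ae_of_all _ fun i => ?_)
      · exact monotone_logOneAdd (mul_le_mul_left (hmono _ hjk) _)
      · exact (continuous_logOneAdd.tendsto _).comp (tendsto_mul_eapprox hθ _ (hLtop _))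
  have hB : Tendsto (fun k => ∫⁻ ω, nexp (ENNReal.ofReal κ *
        ∫⁻ w in Set.Ici (ρ 0 ω), (1 - (1 + e k (ρ 0 ω) * L w)⁻¹)) ∂μ) atTop
      (𝓝 (∫⁻ ω, nexp (ENNReal.ofReal κ *
        ∫⁻ w in Set.Ici (ρ 0 ω), (1 - (1 + θ (ρ 0 ω) * L w)⁻¹)) ∂μ)) := by
    refine tendsto_lintegral_of_dominated_convergence (fun _ => 1) (fun k => ?_)
      (fun k => ae_of_all _ fun ω => nexp_le_one _) (by simp) (ae_of_all _ fun ω => ?_)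
    · exact measurable_nexp.comp (((measurable_lintegral_Ici_mul hL (e k).measurable).comp
        (hρ.measurable 0)).const_mul _)
    · refine (continuous_nexp.tendsto _).comp
        (ENNReal.Tendsto.const_mul ?_ (Or.inr ENNReal.ofReal_ne_top))
      refine lintegral_tendsto_of_tendsto_of_monotone (fun k => ?_)
        (ae_of_all _ fun w j k hjk => ?_) (ae_of_all _ fun w => ?_)
      · exact (measurable_const.sub (measurable_const.add (hL.const_mul _)).inv).aemeasurable
      · refine tsub_le_tsub_left (ENNReal.inv_le_inv.2 ?_) 1
        gcongr
        exact hmono _ hjk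
      · refine ENNReal.Tendsto.sub tendsto_const_nhds ?_ (Or.inl ENNReal.one_ne_top)
        refine tendsto_inv_iff.2 ?_
        exact tendsto_const_nhds.add (tendsto_mul_eapprox hθ _ (hLtop _))
  simp_rw [hkey] at hA
  exact tendsto_nhds_unique hA hB

end NearestParam

/-! ### Rayleigh fading -/

section Fading

variable {Ω : Type*} [MeasurableSpace Ω] {μ : Measure Ω}

lemma expMeasure_lt_ofReal {q : ℝ} (hq : 0 < q) (T : ℝ≥0∞) :
    expMeasure q {x | T < ENNReal.ofReal x} = nexp (ENNReal.ofReal q * T) := by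
  have := isProbabilityMeasure_expMeasure hq
  rcases eq_or_ne T ⊤ with rfl | hT
  · simp [ENNReal.mul_top (ENNReal.ofReal_pos.2 hq).ne']
  · obtain ⟨s, hs, rfl⟩ : ∃ s : ℝ, 0 ≤ s ∧ T = ENNReal.ofReal s :=
      ⟨T.toReal, ENNReal.toReal_nonneg, (ENNReal.ofReal_toReal hT).symm⟩
    have h1 : {x : ℝ | ENNReal.ofReal s < ENNReal.ofReal x} = (Set.Iic s)ᶜ := by
      ext x
      rw [Set.mem_ofPred_eq, ENNReal.ofReal_lt_ofReal_iff']
      simp only [Set.mem_compl_iff, Set.mem_Iic, not_le, and_iff_left_iff_imp]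
      exact fun h => hs.trans_lt h
    have h2 := cdf_expMeasure_eq hq s
    rw [cdf_eq_real, if_pos hs] at h2
    rw [h1, ← ofReal_measureReal, probReal_compl_eq_one_sub measurableSet_Iic, h2,
      ← ENNReal.ofReal_mul hq.le, nexp_ofReal (mul_nonneg hq.le hs)]
    congr 1
    ring

/-- Exponential tilting: multiplying the density of rate `r` by `e^{-s x}` gives `r / (r + s)` times
the density of rate `r + s`. -/
lemma lintegral_nexp_expMeasure {r : ℝ} (hr : 0 < r) {s : ℝ} (hs : 0 ≤ s) :
    ∫⁻ x, nexp (ENNReal.ofReal s * ENNReal.ofReal x) ∂(expMeasure r)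
      = (1 + ENNReal.ofReal (s / r))⁻¹ := by
  have hrs : 0 < r + s := by linarith
  have hm : Measurable fun x : ℝ => nexp (ENNReal.ofReal s * ENNReal.ofReal x) :=
    measurable_nexp.comp (ENNReal.measurable_ofReal.const_mul _)
  have hpm : ∀ q, Measurable (exponentialPDF q) := fun q =>
    (measurable_exponentialPDFReal q).ennreal_ofReal
  have hpdf : expMeasure r = volume.withDensity (exponentialPDF r) := rfl
  rw [hpdf, lintegral_withDensity_eq_lintegral_mul _ (hpm r) hm]
  have h1 : ∀ x, (exponentialPDF r * fun x : ℝ => nexp (ENNReal.ofReal s * ENNReal.ofReal x)) x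
      = ENNReal.ofReal (r / (r + s)) * exponentialPDF (r + s) x := by
    intro x
    rw [Pi.mul_apply]
    rcases lt_or_ge x 0 with hx | hx
    · rw [exponentialPDF_of_neg hx, exponentialPDF_of_neg hx, zero_mul, mul_zero]
    · rw [exponentialPDF_of_nonneg hx, exponentialPDF_of_nonneg hx, ← ENNReal.ofReal_mul hs,
        nexp_ofReal (mul_nonneg hs hx), ← ENNReal.ofReal_mul (by positivity),
        ← ENNReal.ofReal_mul (by positivity), mul_assoc, ← Real.exp_add]
      congr 1
      field_simp
      ring_nf
  simp_rw [h1]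
  rw [lintegral_const_mul _ (hpm _),
    lintegral_exponentialPDF_eq_one hrs, mul_one, ← ENNReal.ofReal_one,
    ← ENNReal.ofReal_add zero_le_one (by positivity), ← ENNReal.ofReal_inv_of_pos (by positivity)]
  congr 1
  field_simp

lemma tendsto_nexp_tsum (f : ℕ → ℝ≥0∞) :
    Tendsto (fun n => ∏ i ∈ Finset.range n, nexp (f i)) atTop (𝓝 (nexp (∑' i, f i))) := by
  simp_rw [← nexp_sum]
  exact (continuous_nexp.tendsto _).comp (ENNReal.tendsto_nat_tsum f)

variable [IsProbabilityMeasure μ]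

lemma lintegral_nexp_tsum_expMeasure {G : ℕ → Ω → ℝ} (hG : ∀ i, Measurable (G i)) {r : ℝ}
    (hr : 0 < r) (hlaw : ∀ i, HasLaw (G i) (expMeasure r) μ) (hind : iIndepFun G μ)
    {s : ℕ → ℝ} (hs : ∀ i, 0 ≤ s i) :
    ∫⁻ ω, nexp (∑' i, ENNReal.ofReal (s i) * ENNReal.ofReal (G i ω)) ∂μ
      = nexp (∑' i, logOneAdd (ENNReal.ofReal (s i / r))) := by
  have hm : ∀ i, Measurable fun x : ℝ => nexp (ENNReal.ofReal (s i) * ENNReal.ofReal x) :=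
    fun i => measurable_nexp.comp (ENNReal.measurable_ofReal.const_mul _)
  have hL : Tendsto (fun n => ∫⁻ ω, ∏ i ∈ Finset.range n,
      nexp (ENNReal.ofReal (s i) * ENNReal.ofReal (G i ω)) ∂μ) atTop
      (𝓝 (∫⁻ ω, nexp (∑' i, ENNReal.ofReal (s i) * ENNReal.ofReal (G i ω)) ∂μ)) := by
    refine tendsto_lintegral_of_dominated_convergence (fun _ => 1) (fun k => ?_)
      (fun k => ae_of_all _ fun ω => ?_) (by simp) (ae_of_all _ fun ω => tendsto_nexp_tsum _)
    · exact Finset.measurable_fun_prod _ fun i _ => (hm i).comp (hG i)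
    · exact Finset.prod_le_one' fun i _ => nexp_le_one _
  have hval : ∀ n, ∫⁻ ω, ∏ i ∈ Finset.range n,
      nexp (ENNReal.ofReal (s i) * ENNReal.ofReal (G i ω)) ∂μ
      = ∏ i ∈ Finset.range n, nexp (logOneAdd (ENNReal.ofReal (s i / r))) := by
    intro n
    have h1 := lintegral_prod_eq_prod_lintegral_of_indepFun (Finset.range n) _
      (hind.comp (fun i x => nexp (ENNReal.ofReal (s i) * ENNReal.ofReal x)) hm)
      (fun i => (hm i).comp (hG i))
    simp only [Function.comp_apply] at h1
    rw [h1]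
    refine Finset.prod_congr rfl fun i _ => ?_
    rw [nexp_logOneAdd, ← lintegral_nexp_expMeasure hr (hs i), ← (hlaw i).map_eq,
      lintegral_map (hm i) (hG i)]
  simp_rw [hval] at hL
  exact tendsto_nhds_unique hL (tendsto_nexp_tsum _)

/-- Conditionally on the interference `T`, the exponential gain exceeds it with probability `e^{-q
T}`. What remains is the Laplace transform of a sum of independent exponentials. -/
lemma measure_tsum_lt_ofReal {g : ℕ → Ω → ℝ} (hg : ∀ i, Measurable (g i)) (hind : iIndepFun g μ)
    {q r : ℝ} (hq : 0 < q) (hr : 0 < r) (hg0 : HasLaw (g 0) (expMeasure q) μ)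
    (hgi : ∀ i, HasLaw (g (i + 1)) (expMeasure r) μ) {c : ℕ → ℝ} (hc : ∀ i, 0 ≤ c i) :
    μ {ω | ∑' i, ENNReal.ofReal (c i) * ENNReal.ofReal (g (i + 1) ω) < ENNReal.ofReal (g 0 ω)}
      = nexp (∑' i, logOneAdd (ENNReal.ofReal (q * c i / r))) := by
  have hindG : iIndepFun (fun i => g (i + 1)) μ := hind.precomp (add_left_injective 1)
  -- Independence from the whole sequence is tested on its finite subfamilies.
  have hproc : IndepFun (g 0) (fun ω i => g (i + 1) ω) μ := by
    refine IndepFun.indepFun_process (hg 0) (fun i => hg _) fun I => ?_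
    let S : Finset ℕ := {0}
    let T : Finset ℕ := I.image (· + 1)
    have hST : Disjoint S T := by simp [S, T]
    have := hind.indepFun_finset S T hST hg
    refine this.comp (φ := fun x => x ⟨0, by simp [S]⟩)
      (ψ := fun x (i : I) => x ⟨i + 1, by simp [T]⟩) ?_ ?_
    · fun_prop
    · fun_prop
  set T : (ℕ → ℝ) → ℝ≥0∞ := fun x => ∑' i, ENNReal.ofReal (c i) * ENNReal.ofReal (x i) with hT
  have hTm : Measurable T := Measurable.tsum fun i =>
    (ENNReal.measurable_ofReal.comp (measurable_pi_apply i)).const_mul _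
  have hGm : Measurable fun ω i => g (i + 1) ω := measurable_pi_lambda _ fun i => hg _
  have hIT : IndepFun (fun ω => T fun i => g (i + 1) ω) (g 0) μ :=
    (hproc.symm.comp hTm measurable_id)
  have hprod := (indepFun_iff_map_prod_eq_prod_map_map (hTm.comp hGm).aemeasurable
    (hg 0).aemeasurable).1 hIT
  have hset : MeasurableSet {p : ℝ≥0∞ × ℝ | p.1 < ENNReal.ofReal p.2} :=
    measurableSet_lt measurable_fst (ENNReal.measurable_ofReal.comp measurable_snd)
  have hm2 : Measurable fun ω => ((T fun i => g (i + 1) ω), g 0 ω) :=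
    (hTm.comp hGm).prodMk (hg 0)
  have h1 : μ {ω | T (fun i => g (i + 1) ω) < ENNReal.ofReal (g 0 ω)}
      = μ.map (fun ω => ((T fun i => g (i + 1) ω), g 0 ω)) {p | p.1 < ENNReal.ofReal p.2} := by
    rw [Measure.map_apply hm2 hset]
    rfl
  have : IsProbabilityMeasure (expMeasure q) := isProbabilityMeasure_expMeasure hq
  rw [show {ω | ∑' i, ENNReal.ofReal (c i) * ENNReal.ofReal (g (i + 1) ω) < ENNReal.ofReal (g 0 ω)}
    = {ω | T (fun i => g (i + 1) ω) < ENNReal.ofReal (g 0 ω)} from rfl, h1]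
  refine (congrArg (fun m => m {p : ℝ≥0∞ × ℝ | p.1 < ENNReal.ofReal p.2}) hprod).trans ?_
  rw [hg0.map_eq, Measure.prod_apply hset]
  have h2 : ∀ t : ℝ≥0∞, expMeasure q (Prod.mk t ⁻¹' {p : ℝ≥0∞ × ℝ | p.1 < ENNReal.ofReal p.2})
      = nexp (ENNReal.ofReal q * t) := fun t => expMeasure_lt_ofReal hq t
  simp_rw [h2]
  rw [lintegral_map (f := fun x => nexp (ENNReal.ofReal q * x))
    (measurable_nexp.comp (measurable_id.const_mul _)) (hTm.comp hGm)]
  simp only [hT, Function.comp_apply]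
  simp_rw [← ENNReal.tsum_mul_left, ← mul_assoc, ← ENNReal.ofReal_mul hq.le]
  exact lintegral_nexp_tsum_expMeasure (fun i => hg (i + 1)) hr hgi hindG
    fun i => mul_nonneg hq.le (hc i)

end Fading

/-! ### Integral representations of the hypergeometric terms -/

/-- Substitute `s = (v / b²)^{α/2}` in Euler's integral. The exponent of `1 - s` is zero, and the
power of `s` cancels against the Jacobian. For `α = 0` the integrand is constant and equals the
value assigned to `omega2` there. -/
lemma sq_mul_omega2 {b c α : ℝ} (hb : 0 ≤ b) (hα : 0 ≤ α) :
    b ^ 2 * omega2 (b ^ α / c) α = ∫ v in 0..b ^ 2, (1 + v ^ (α / 2) / c)⁻¹ := by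
  rcases hα.eq_or_lt with rfl | hα
  · simp [omega2]
  rcases hb.eq_or_lt with rfl | hb
  · simp
  have ha : 0 < 2 / α := by positivity
  have hb2 : 0 < b ^ 2 := by positivity
  have hcoef : Real.Gamma (1 + 2 / α) / (Real.Gamma (2 / α) * Real.Gamma (1 + 2 / α - 2 / α))
      = 2 / α := by
    rw [add_sub_cancel_right, Real.Gamma_one, mul_one, add_comm, Real.Gamma_add_one ha.ne']
    exact mul_div_cancel_right₀ _ (Real.Gamma_pos_of_pos ha).ne'
  have hbα : (b ^ 2) ^ (α / 2) = b ^ α := by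
    rw [← Real.rpow_natCast, ← Real.rpow_mul hb.le]
    congr 1
    push_cast
    ring
  let f : ℝ → ℝ := fun v => (v / b ^ 2) ^ (α / 2)
  let f' : ℝ → ℝ := fun v => 1 / b ^ 2 * (α / 2) * (v / b ^ 2) ^ (α / 2 - 1)
  have hsub := intervalIntegral.integral_comp_mul_deriv_of_deriv_nonneg (a := 0) (b := b ^ 2)
    (f := f) (f' := f') (g := fun s => s ^ (2 / α - 1) * (1 - s) ^ (1 + 2 / α - 2 / α - 1) *
      (1 - -(b ^ α / c) * s) ^ (-(1 : ℝ))) ?_ ?_ ?_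
  · have hf0 : f 0 = 0 := by
      simp only [f, zero_div]
      exact Real.zero_rpow (by positivity)
    have hf1 : f (b ^ 2) = 1 := by
      simp only [f, div_self hb2.ne', Real.one_rpow]
    rw [hf0, hf1] at hsub
    rw [omega2, if_neg hα.ne', gaussHyp, hcoef, ← hsub, ← mul_assoc,
      ← intervalIntegral.integral_const_mul]
    refine intervalIntegral.integral_congr_ae (ae_of_all _ fun v hv => ?_)
    rw [Set.uIoc_of_le hb2.le] at hv
    have hv0 : 0 < v / b ^ 2 := div_pos hv.1 hb2
    have h1 : (1 : ℝ) + 2 / α - 2 / α - 1 = 0 := by ring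
    have h2 : f v ^ (2 / α - 1) * (v / b ^ 2) ^ (α / 2 - 1) = 1 := by
      simp only [f]
      rw [← Real.rpow_mul hv0.le, ← Real.rpow_add hv0]
      have : α / 2 * (2 / α - 1) + (α / 2 - 1) = 0 := by
        field_simp
        ring
      rw [this, Real.rpow_zero]
    have h3 : 1 - -(b ^ α / c) * f v = 1 + v ^ (α / 2) / c := by
      simp only [f]
      rw [Real.div_rpow hv.1.le hb2.le, hbα]
      have : b ^ α ≠ 0 := (Real.rpow_pos_of_pos hb _).ne'
      field_simp
      ring
    simp only [Function.comp, f']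
    rw [h1, Real.rpow_zero, mul_one, h3, Real.rpow_neg_one]
    calc _ = (f v ^ (2 / α - 1) * (v / b ^ 2) ^ (α / 2 - 1)) *
          ((b ^ 2 * (1 / b ^ 2)) * (2 / α * (α / 2))) * (1 + v ^ (α / 2) / c)⁻¹ := by ring
      _ = _ := by
        rw [h2, mul_one_div_cancel hb2.ne', div_mul_div_comm, mul_comm 2 α,
          div_self (by positivity)]
        ring
  · exact ((continuous_id.div_const _).rpow_const fun _ => Or.inr (by positivity)).continuousOn
  · intro v hv
    rw [min_eq_left hb2.le] at hv
    exact ((hasDerivAt_id v).div_const _).rpow_const (Or.inl (div_pos hv.1 hb2).ne')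
  · intro v hv
    rw [min_eq_left hb2.le] at hv
    have hv0 : 0 < v / b ^ 2 := div_pos hv.1 hb2
    positivity

/-- The decreasing substitution `s = (v / d²)^{-y/2}` maps `(d², ∞)` onto `(0, 1)`. The condition `y
> 2` makes `1 - 2/y` positive, as Euler's integral requires. -/
lemma sq_mul_delta {d t y : ℝ} (hd : 0 < d) (ht : 0 < t) (hy : 2 < y) :
    d ^ 2 * delta t y = ∫ v in Set.Ioi (d ^ 2), (1 + v ^ (y / 2) / (t * d ^ y))⁻¹ := by
  have hy0 : 0 < y := by linarith
  have ha : 0 < 1 - 2 / y := by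
    rw [sub_pos, div_lt_one hy0]
    exact hy
  have hd2 : 0 < d ^ 2 := by positivity
  have hcoef : Real.Gamma (2 - 2 / y) / (Real.Gamma (1 - 2 / y) *
      Real.Gamma (2 - 2 / y - (1 - 2 / y))) = 1 - 2 / y := by
    rw [show 2 - 2 / y - (1 - 2 / y) = 1 by ring, Real.Gamma_one, mul_one,
      show 2 - 2 / y = (1 - 2 / y) + 1 by ring, Real.Gamma_add_one ha.ne']
    exact mul_div_cancel_right₀ _ (Real.Gamma_pos_of_pos ha).ne'
  have hdy : (d ^ 2) ^ (y / 2) = d ^ y := by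
    rw [← Real.rpow_natCast, ← Real.rpow_mul hd.le]
    congr 1
    push_cast
    ring
  let f : ℝ → ℝ := fun v => (v / d ^ 2) ^ (-(y / 2))
  let f' : ℝ → ℝ := fun v => 1 / d ^ 2 * (-(y / 2)) * (v / d ^ 2) ^ (-(y / 2) - 1)
  have hanti : StrictAntiOn f (Set.Ioi (d ^ 2)) := by
    intro u hu v hv huv
    have hu0 : 0 < u := hd2.trans hu
    exact Real.rpow_lt_rpow_of_neg (by positivity) (by gcongr) (by linarith)
  have himage : f '' Set.Ioi (d ^ 2) = Set.Ioo 0 1 := by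
    ext s
    constructor
    · rintro ⟨v, hv, rfl⟩
      have h1 : 1 < v / d ^ 2 := (one_lt_div hd2).2 hv
      exact ⟨by positivity, Real.rpow_lt_one_of_one_lt_of_neg h1 (by linarith)⟩
    · rintro ⟨hs0, hs1⟩
      refine ⟨s ^ (-(2 / y)) * d ^ 2, ?_, ?_⟩
      · have : 1 < s ^ (-(2 / y)) := Real.one_lt_rpow_of_pos_of_lt_one_of_neg hs0 hs1
          (neg_lt_zero.2 (by positivity))
        exact lt_mul_of_one_lt_left hd2 this
      · simp only [f]
        rw [mul_div_cancel_right₀ _ hd2.ne', ← Real.rpow_mul hs0.le]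
        have : -(2 / y) * -(y / 2) = 1 := by field_simp
        rw [this, Real.rpow_one]
  have hsub := integral_image_eq_integral_abs_deriv_smul (s := Set.Ioi (d ^ 2)) (f := f) (f' := f')
    measurableSet_Ioi (fun v hv => ?_) hanti.injOn
    (fun s => s ^ (1 - 2 / y - 1) * (1 - s) ^ (2 - 2 / y - (1 - 2 / y) - 1) *
      (1 - -t * s) ^ (-(1 : ℝ)))
  · rw [himage, ← integral_Ioc_eq_integral_Ioo, ← intervalIntegral.integral_of_le zero_le_one] at hsub
    rw [delta, omega1, gaussHyp, hcoef, hsub, ← integral_const_mul, ← integral_const_mul,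
      ← integral_div, ← integral_const_mul]
    refine setIntegral_congr_fun measurableSet_Ioi fun v hv => ?_
    have hv' : 0 < v := hd2.trans hv
    have hv0 : 0 < v / d ^ 2 := by positivity
    have h1 : (2 : ℝ) - 2 / y - (1 - 2 / y) - 1 = 0 := by ring
    have h2 : f v ^ (1 - 2 / y - 1) = v / d ^ 2 := by
      simp only [f]
      rw [← Real.rpow_mul hv0.le]
      have : -(y / 2) * (1 - 2 / y - 1) = 1 := by
        field_simp
        ring
      rw [this, Real.rpow_one]
    have h3 : |f' v| = y / 2 / d ^ 2 * (f v * (v / d ^ 2)⁻¹) := by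
      simp only [f', f]
      rw [Real.rpow_sub hv0, Real.rpow_one, abs_mul, abs_mul, abs_neg, abs_of_pos (a := y / 2)
        (by positivity), abs_of_pos (a := 1 / d ^ 2) (by positivity), abs_of_pos (by positivity)]
      ring
    have hf : f v = d ^ y / v ^ (y / 2) := by
      simp only [f]
      rw [Real.rpow_neg hv0.le, Real.div_rpow hv'.le hd2.le, hdy, inv_div]
    have hvp : 0 < v ^ (y / 2) := Real.rpow_pos_of_pos hv' _
    have hdp : 0 < d ^ y := Real.rpow_pos_of_pos hd _
    simp only [smul_eq_mul]
    rw [h1, Real.rpow_zero, mul_one, h2, h3, Real.rpow_neg_one, hf]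
    have hy2 : y - 2 ≠ 0 := by linarith
    have h4 : 1 - -t * (d ^ y / v ^ (y / 2)) = (v ^ (y / 2) + t * d ^ y) / v ^ (y / 2) := by
      field_simp
      ring
    have h5 : 1 + v ^ (y / 2) / (t * d ^ y) = (v ^ (y / 2) + t * d ^ y) / (t * d ^ y) := by
      field_simp
      ring
    have h6 : 0 < v ^ (y / 2) + t * d ^ y := by positivity
    rw [h4, h5]
    field_simp
  · have hv0 : 0 < v / d ^ 2 := div_pos (hd2.trans hv) hd2
    exact (((hasDerivAt_id v).div_const _).rpow_const (Or.inl hv0.ne')).hasDerivWithinAt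

lemma measurable_inv_one_add_rpow (c α : ℝ) : Measurable fun v : ℝ => (1 + v ^ (α / 2) / c)⁻¹ := by
  fun_prop

lemma inv_one_add_rpow_le_one {c : ℝ} (hc : 0 < c) (α : ℝ) {v : ℝ} (hv : 0 ≤ v) :
    (1 + v ^ (α / 2) / c)⁻¹ ≤ 1 :=
  inv_le_one_of_one_le₀ (le_add_of_nonneg_right (by positivity))

lemma intervalIntegrable_inv_one_add_rpow {c : ℝ} (hc : 0 < c) (α : ℝ) {u v : ℝ} (hu : 0 ≤ u)
    (hv : 0 ≤ v) : IntervalIntegrable (fun v : ℝ => (1 + v ^ (α / 2) / c)⁻¹) volume u v := by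
  refine (intervalIntegrable_const (c := (1 : ℝ))).mono_fun
    (measurable_inv_one_add_rpow c α).aestronglyMeasurable ?_
  refine (ae_restrict_iff' measurableSet_uIoc).2 (ae_of_all _ fun x hx => ?_)
  have hx0 : 0 ≤ x := (le_min hu hv).trans hx.1.le
  change ‖(1 + x ^ (α / 2) / c)⁻¹‖ ≤ ‖(1 : ℝ)‖
  rw [norm_one, Real.norm_of_nonneg (by positivity)]
  exact inv_one_add_rpow_le_one hc α hx0

lemma integrableOn_inv_one_add_rpow {c α : ℝ} (hc : 0 < c) (hα : 2 < α) :
    IntegrableOn (fun v : ℝ => (1 + v ^ (α / 2) / c)⁻¹) (Set.Ioi 0) := by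
  rw [← Set.Ioc_union_Ioi_eq_Ioi zero_le_one]
  refine IntegrableOn.union ?_ ?_
  · rw [← intervalIntegrable_iff_integrableOn_Ioc_of_le zero_le_one]
    exact intervalIntegrable_inv_one_add_rpow hc α le_rfl zero_le_one
  · refine ((integrableOn_Ioi_rpow_of_lt (a := -(α / 2)) (by linarith) one_pos).const_mul c).mono'
      (measurable_inv_one_add_rpow c α).aestronglyMeasurable ?_
    refine (ae_restrict_iff' measurableSet_Ioi).2 (ae_of_all _ fun x hx => ?_)
    have hx0 : 0 < x := one_pos.trans hx
    rw [Real.norm_of_nonneg (by positivity), Real.rpow_neg hx0.le]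
    have hxp : 0 < x ^ (α / 2) := Real.rpow_pos_of_pos hx0 _
    calc (1 + x ^ (α / 2) / c)⁻¹ ≤ (x ^ (α / 2) / c)⁻¹ := by gcongr; linarith
      _ = _ := by rw [inv_div, div_eq_mul_inv]

lemma tendsto_sq_mul_omega2 {c α : ℝ} (hc : 0 < c) (hα : 2 < α) :
    Tendsto (fun x : ℝ => x ^ 2 * omega2 (x ^ α / c) α) atTop
      (𝓝 (∫ v in Set.Ioi 0, (1 + v ^ (α / 2) / c)⁻¹)) := by
  have h := intervalIntegral_tendsto_integral_Ioi 0 (integrableOn_inv_one_add_rpow hc hα)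
    (tendsto_pow_atTop (α := ℝ) two_ne_zero)
  refine h.congr' ?_
  filter_upwards [eventually_ge_atTop 0] with x hx
  exact (sq_mul_omega2 hx (by linarith)).symm

/-! ### The multi-slope pathloss -/

section Pathloss

variable {N : ℕ} {R α b : ℕ → ℝ}

lemma edge_le_edge (hb : ∀ n, n + 1 < N → b n < b (n + 1)) {n m : ℕ} (hnm : n ≤ m) (hm : m < N) :
    b n ≤ b m := by
  induction m, hnm using Nat.le_induction with
  | base => exact le_rfl
  | succ k hk ih => exact (ih (by omega)).trans (hb k hm).le

lemma eq_of_mem_band (hb : ∀ n, n + 1 < N → b n < b (n + 1)) {n m : ℕ} (hn : n < N) (hm : m < N)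
    {x : ℝ} (hxn : x ∈ band N b n) (hxm : x ∈ band N b m) : n = m := by
  have key : ∀ {i j : ℕ}, j < N → x ∈ band N b i → x ∈ band N b j → ¬ i < j := by
    intro i j hj hi hj' hij
    exact absurd ((edge_le_edge hb hij hj).trans hj'.1) (not_le.2 (hi.2 (by omega)))
  exact le_antisymm (not_lt.1 (key hn hxm hxn)) (not_lt.1 (key hm hxn hxm))

lemma exists_mem_band (hN : 1 ≤ N) {x : ℝ} (hx : b 0 ≤ x) : ∃ n < N, x ∈ band N b n := by
  classical
  refine ⟨Nat.findGreatest (fun n => b n ≤ x) (N - 1), ?_, ?_, fun h => ?_⟩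
  · have := Nat.findGreatest_le (P := fun n => b n ≤ x) (N - 1)
    omega
  · exact Nat.findGreatest_spec (P := fun n => b n ≤ x) (Nat.zero_le _) hx
  · exact not_le.1 (Nat.findGreatest_is_greatest (P := fun n => b n ≤ x) (Nat.lt_succ_self _)
      (by omega))

lemma measurableSet_band (n : ℕ) : MeasurableSet (band N b n) := by
  by_cases h : n + 1 < N
  · have : band N b n = Set.Ico (b n) (b (n + 1)) := by
      ext x; simp [band, h]
    rw [this]
    exact measurableSet_Ico
  · have : band N b n = Set.Ici (b n) := by
      ext x; simp [band, h]
    rw [this]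
    exact measurableSet_Ici

lemma measurable_pathloss : Measurable (pathloss N R α b) := by
  classical
  refine Finset.measurable_fun_sum _ fun n _ => ?_
  exact Measurable.ite (measurableSet_band n) (by fun_prop) measurable_const

lemma pathloss_of_mem_band (hb : ∀ n, n + 1 < N → b n < b (n + 1)) {n : ℕ} (hn : n < N) {x : ℝ}
    (hx : x ∈ band N b n) : pathloss N R α b x = slopeConst R α n * x ^ (-α n) := by
  rw [pathloss, Finset.sum_eq_single n, if_pos hx]
  · intro m hm hmn
    exact if_neg fun h => hmn (eq_of_mem_band hb (Finset.mem_range.1 hm) hn h hx)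
  · intro h
    exact absurd (Finset.mem_range.2 hn) h

lemma slopeConst_pos (hR0 : R 0 = 0) (hR : ∀ n, n + 1 < N → R n < R (n + 1)) {n : ℕ} (hn : n < N) :
    0 < slopeConst R α n := by
  refine Finset.prod_pos fun i hi => Real.rpow_pos_of_pos ?_ _
  have hi' := Finset.mem_range.1 hi
  have h0 : R 0 ≤ R i := edge_le_edge hR (Nat.zero_le i) (by omega)
  rw [hR0] at h0
  exact h0.trans_lt (hR i (by omega))

lemma pathloss_pos (hN : 1 ≤ N) (hK : ∀ n < N, 0 < slopeConst R α n)
    (hb : ∀ n, n + 1 < N → b n < b (n + 1)) {x : ℝ} (hx : 0 < x) (hbx : b 0 ≤ x) :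
    0 < pathloss N R α b x := by
  obtain ⟨n, hn, hxn⟩ := exists_mem_band hN hbx
  rw [pathloss_of_mem_band hb hn hxn]
  exact mul_pos (hK n hn) (Real.rpow_pos_of_pos hx _)

lemma pathloss_nonneg (hK : ∀ n < N, 0 < slopeConst R α n) {x : ℝ} (hx : 0 ≤ x) :
    0 ≤ pathloss N R α b x := by
  refine Finset.sum_nonneg fun n hn => ?_
  split_ifs
  · exact mul_nonneg (hK n (Finset.mem_range.1 hn)).le (Real.rpow_nonneg hx _)
  · exact le_rfl

/-- Antenna distances stay above `Δh > 0`, so a bounded band contributes a bounded function on a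
bounded interval. On the last band the pathloss decays like `w^{-α/2}` with `α / 2 > 1`. -/
lemma lintegral_pathloss_ne_top (hN : 1 ≤ N) (hK : ∀ n < N, 0 < slopeConst R α n)
    (hα : ∀ n < N, 0 ≤ α n) (hα2 : 2 < α (N - 1)) {Δh : ℝ} (hΔh : 0 < Δh) :
    ∫⁻ w in Set.Ici 0, ENNReal.ofReal (pathloss N R α b (√(w + Δh ^ 2))) ≠ ⊤ := by
  classical
  have hsum : ∀ w : ℝ, ENNReal.ofReal (pathloss N R α b (√(w + Δh ^ 2)))
      = ∑ n ∈ Finset.range N, ENNReal.ofReal (if √(w + Δh ^ 2) ∈ band N b n then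
        slopeConst R α n * √(w + Δh ^ 2) ^ (-α n) else 0) := by
    intro w
    rw [pathloss, ENNReal.ofReal_sum_of_nonneg]
    intro n hn
    split_ifs
    · exact mul_nonneg (hK n (Finset.mem_range.1 hn)).le (Real.rpow_nonneg (Real.sqrt_nonneg _) _)
    · exact le_rfl
  simp_rw [hsum]
  have hm : ∀ n, Measurable fun w : ℝ => ENNReal.ofReal (if √(w + Δh ^ 2) ∈ band N b n then
        slopeConst R α n * √(w + Δh ^ 2) ^ (-α n) else 0) := fun n =>
    (Measurable.ite (measurableSet_preimage (by fun_prop) (measurableSet_band n)) (by fun_prop)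
      measurable_const).ennreal_ofReal
  rw [lintegral_finsetSum _ fun n _ => hm n]
  refine (ENNReal.sum_lt_top.2 fun n hn => ?_).ne
  have hnN := Finset.mem_range.1 hn
  have hle : ∀ w ∈ Set.Ici (0 : ℝ), Δh ≤ √(w + Δh ^ 2) := fun w hw =>
    Real.le_sqrt_of_sq_le (le_add_of_nonneg_left hw)
  by_cases h : n + 1 < N
  · calc _ ≤ ∫⁻ w in Set.Ici 0, (Set.Icc 0 (b (n + 1) ^ 2)).indicator
          (fun _ => ENNReal.ofReal (slopeConst R α n * Δh ^ (-α n))) w := by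
          refine setLIntegral_mono' measurableSet_Ici fun w hw => ?_
          split_ifs with hband
          · rw [Set.indicator_of_mem]
            · refine ENNReal.ofReal_le_ofReal (mul_le_mul_of_nonneg_left ?_ (hK n hnN).le)
              exact Real.rpow_le_rpow_of_nonpos hΔh (hle w hw) (neg_nonpos.2 (hα n hnN))
            · refine ⟨hw, ?_⟩
              have h1 := hband.2 h
              have h2 : √(w + Δh ^ 2) ^ 2 ≤ b (n + 1) ^ 2 :=
                pow_le_pow_left₀ (Real.sqrt_nonneg _) h1.le 2
              rw [Real.sq_sqrt (add_nonneg hw (sq_nonneg _))] at h2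
              nlinarith [sq_nonneg Δh]
          · simp
      _ ≤ ∫⁻ w, (Set.Icc 0 (b (n + 1) ^ 2)).indicator
          (fun _ => ENNReal.ofReal (slopeConst R α n * Δh ^ (-α n))) w :=
          setLIntegral_le_lintegral _ _
      _ < ⊤ := by
          rw [lintegral_indicator_const measurableSet_Icc]
          exact ENNReal.mul_lt_top ENNReal.ofReal_lt_top measure_Icc_lt_top
  · obtain rfl : n = N - 1 := by omega
    have hi : IntegrableOn (fun w : ℝ => slopeConst R α (N - 1) *
        (w + Δh ^ 2) ^ (-(α (N - 1) / 2))) (Set.Ici 0) := by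
      rw [integrableOn_Ici_iff_integrableOn_Ioi]
      exact (integrableOn_add_rpow_Ioi_of_lt (by linarith)
        (neg_lt_zero.2 (by positivity))).const_mul _
    refine lt_of_le_of_lt (setLIntegral_mono' measurableSet_Ici fun w hw => ?_) hi.lintegral_lt_top
    refine ENNReal.ofReal_le_ofReal ?_
    have hw0 : 0 ≤ w + Δh ^ 2 := add_nonneg hw (sq_nonneg _)
    have he : √(w + Δh ^ 2) ^ (-α (N - 1)) = (w + Δh ^ 2) ^ (-(α (N - 1) / 2)) := by
      rw [Real.sqrt_eq_rpow, ← Real.rpow_mul hw0]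
      congr 1
      ring
    rw [he]
    split_ifs
    · exact le_rfl
    · exact mul_nonneg (hK _ hnN).le (Real.rpow_nonneg hw0 _)

/-! ### The exponent as an integral over squared antenna distances -/

/-- The integrand of the exponent at antenna distance `√x`: `s * l / (1 + s * l)` for the pathloss
`l`. -/
def interferenceWeight (N : ℕ) (R α b : ℕ → ℝ) (s x : ℝ) : ℝ :=
  1 - (1 + s * pathloss N R α b (√x))⁻¹

lemma interferenceWeight_of_mem_band (hK : ∀ n < N, 0 < slopeConst R α n)
    (hb : ∀ n, n + 1 < N → b n < b (n + 1)) {s : ℝ} (hs : 0 < s) {i : ℕ} (hi : i < N) {x : ℝ}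
    (hx : 0 < x) (hxi : √x ∈ band N b i) :
    interferenceWeight N R α b s x = (1 + x ^ (α i / 2) / (s * slopeConst R α i))⁻¹ := by
  have he : √x ^ (-α i) = (x ^ (α i / 2))⁻¹ := by
    rw [Real.sqrt_eq_rpow, ← Real.rpow_mul hx.le, ← Real.rpow_neg hx.le]
    congr 1
    ring
  have hxp : 0 < x ^ (α i / 2) := Real.rpow_pos_of_pos hx _
  have hKi := hK i hi
  rw [interferenceWeight, pathloss_of_mem_band hb hi hxi, he]
  field_simp
  ring

lemma upperTerm_of_lt {c : ℝ} {i : ℕ} (h : i + 1 < N) (hbi : 0 ≤ b (i + 1)) (hα : 0 ≤ α i) :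
    upperTerm N α b c i = ∫ v in 0..b (i + 1) ^ 2, (1 + v ^ (α i / 2) / c)⁻¹ := by
  rw [upperTerm, if_pos h, sq_mul_omega2 hbi hα]

lemma upperTerm_last {c : ℝ} (hN : 1 ≤ N) (hc : 0 < c) (hα2 : 2 < α (N - 1)) :
    upperTerm N α b c (N - 1) = ∫ v in Set.Ioi 0, (1 + v ^ (α (N - 1) / 2) / c)⁻¹ := by
  rw [upperTerm, if_neg (by omega)]
  exact (tendsto_sq_mul_omega2 hc hα2).limUnder_eq

/-- Induction on the number `k` of bands above that of `a`: the integral is split at the next edge,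
and each band contributes a difference of values of its own primitive. Letting `a` be any point of
band `i` covers both the serving distance and the lower edges met in the recursion. -/
lemma interferenceWeight_tail (hK : ∀ n < N, 0 < slopeConst R α n)
    (hb0 : 0 ≤ b 0) (hb : ∀ n, n + 1 < N → b n < b (n + 1)) (hα : ∀ n < N, 0 ≤ α n)
    (hα2 : 2 < α (N - 1)) {s : ℝ} (hs : 0 < s) (k : ℕ) :
    ∀ i, i + k + 1 = N → ∀ a ∈ band N b i,
      IntegrableOn (interferenceWeight N R α b s) (Set.Ioi (a ^ 2)) ∧
      ∫ x in Set.Ioi (a ^ 2), interferenceWeight N R α b s x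
        = (upperTerm N α b (s * slopeConst R α i) i
            - ∫ v in 0..a ^ 2, (1 + v ^ (α i / 2) / (s * slopeConst R α i))⁻¹)
          + ∑ j ∈ Finset.Ico (i + 1) N, (upperTerm N α b (s * slopeConst R α j) j
            - lowerTerm α b (s * slopeConst R α j) j) := by
  induction k with
  | zero =>
    intro i hi a ha
    obtain rfl : i = N - 1 := by omega
    have hiN : N - 1 < N := by omega
    have hc : 0 < s * slopeConst R α (N - 1) := mul_pos hs (hK _ hiN)
    have ha0 : 0 ≤ a := (hb0.trans (edge_le_edge hb (Nat.zero_le _) hiN)).trans ha.1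
    have hq : ∀ x ∈ Set.Ioi (a ^ 2), interferenceWeight N R α b s x
        = (1 + x ^ (α (N - 1) / 2) / (s * slopeConst R α (N - 1)))⁻¹ := by
      intro x hx
      refine interferenceWeight_of_mem_band hK hb hs hiN ((sq_nonneg a).trans_lt hx) ⟨?_, ?_⟩
      · exact ha.1.trans (Real.le_sqrt_of_sq_le (le_of_lt hx))
      · omega
    have hint := integrableOn_inv_one_add_rpow hc hα2
    have hint' := hint.mono_set (Set.Ioi_subset_Ioi (sq_nonneg a))
    refine ⟨hint'.congr_fun (fun x hx => (hq x hx).symm) measurableSet_Ioi, ?_⟩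
    rw [setIntegral_congr_fun measurableSet_Ioi hq, upperTerm_last (by omega) hc hα2,
      Finset.Ico_eq_empty (by omega), Finset.sum_empty, add_zero,
      ← intervalIntegral.integral_interval_add_Ioi hint hint']
    ring
  | succ k ih =>
    intro i hi a ha
    have hiN : i < N := by omega
    have hi1 : i + 1 < N := by omega
    have hc : 0 < s * slopeConst R α i := mul_pos hs (hK _ hiN)
    have ha0 : 0 ≤ a := (hb0.trans (edge_le_edge hb (Nat.zero_le _) hiN)).trans ha.1
    have hab : a < b (i + 1) := ha.2 hi1
    have hb1 : 0 ≤ b (i + 1) := ha0.trans hab.le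
    have hab2 : a ^ 2 ≤ b (i + 1) ^ 2 := pow_le_pow_left₀ ha0 hab.le 2
    obtain ⟨hI, hv⟩ := ih (i + 1) (by omega) (b (i + 1)) ⟨le_rfl, fun h => hb _ h⟩
    have hq : ∀ x ∈ Set.Ioo (a ^ 2) (b (i + 1) ^ 2), interferenceWeight N R α b s x
        = (1 + x ^ (α i / 2) / (s * slopeConst R α i))⁻¹ := by
      intro x hx
      refine interferenceWeight_of_mem_band hK hb hs hiN ((sq_nonneg a).trans_lt hx.1)
        ⟨ha.1.trans (Real.le_sqrt_of_sq_le hx.1.le), fun _ => ?_⟩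
      exact (Real.sqrt_lt' (ha0.trans_lt hab)).2 hx.2
    have hqae : ∀ᵐ x, x ∈ Set.uIoc (a ^ 2) (b (i + 1) ^ 2) →
        (1 + x ^ (α i / 2) / (s * slopeConst R α i))⁻¹ = interferenceWeight N R α b s x := by
      -- The right endpoint already belongs to the next band, but it is a null set.
      have hne : ∀ᵐ x : ℝ, x ≠ b (i + 1) ^ 2 := by simp [ae_iff, measure_singleton]
      filter_upwards [hne] with x hx hxm
      rw [Set.uIoc_of_le hab2] at hxm
      exact (hq x ⟨hxm.1, lt_of_le_of_ne hxm.2 hx⟩).symm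
    have hi0 := intervalIntegrable_inv_one_add_rpow hc (α i) (sq_nonneg a) (sq_nonneg (b (i + 1)))
    have hi1' : IntervalIntegrable (interferenceWeight N R α b s) volume (a ^ 2) (b (i + 1) ^ 2) :=
      hi0.congr_ae ((ae_restrict_iff' measurableSet_uIoc).2 hqae)
    have hIoc : IntegrableOn (interferenceWeight N R α b s) (Set.Ioc (a ^ 2) (b (i + 1) ^ 2)) :=
      (intervalIntegrable_iff_integrableOn_Ioc_of_le hab2).1 hi1'
    have hall : IntegrableOn (interferenceWeight N R α b s) (Set.Ioi (a ^ 2)) := by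
      rw [← Set.Ioc_union_Ioi_eq_Ioi hab2]
      exact hIoc.union hI
    refine ⟨hall, ?_⟩
    rw [← intervalIntegral.integral_interval_add_Ioi hall hI, hv,
      ← intervalIntegral.integral_congr_ae hqae, upperTerm_of_lt hi1 hb1 (hα i hiN),
      Finset.sum_eq_sum_Ico_succ_bot (by omega : i + 1 < N),
      ← intervalIntegral.integral_interval_sub_left
        (intervalIntegrable_inv_one_add_rpow hc (α i) le_rfl (sq_nonneg _))
        (intervalIntegrable_inv_one_add_rpow hc (α i) le_rfl (sq_nonneg _)),
      lowerTerm, sq_mul_omega2 hb1 (hα _ hi1)]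

lemma exponentTerm_eq_integral (hK : ∀ n < N, 0 < slopeConst R α n)
    (hb0 : 0 ≤ b 0) (hb : ∀ n, n + 1 < N → b n < b (n + 1)) (hα : ∀ n < N, 0 ≤ α n)
    (hα2 : 2 < α (N - 1)) {t d : ℝ} (ht : 0 < t) (hd : 0 < d) {n : ℕ} (hn : n < N)
    (hdn : d ∈ band N b n) :
    IntegrableOn (interferenceWeight N R α b (t / pathloss N R α b d)) (Set.Ioi (d ^ 2)) ∧
    ∫ x in Set.Ioi (d ^ 2), interferenceWeight N R α b (t / pathloss N R α b d) x
      = exponentTerm N R α b t d n := by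
  have hdp : 0 < d ^ α n := Real.rpow_pos_of_pos hd _
  have hKn := hK n hn
  have hl : pathloss N R α b d = slopeConst R α n * (d ^ α n)⁻¹ := by
    rw [pathloss_of_mem_band hb hn hdn, Real.rpow_neg hd.le]
  have hlpos : 0 < pathloss N R α b d := by
    rw [hl]
    positivity
  obtain ⟨hI, hv⟩ := interferenceWeight_tail (R := R) hK hb0 hb hα hα2 (div_pos ht hlpos) (N - 1 - n)
    n (by omega) d hdn
  refine ⟨hI, hv.trans ?_⟩
  -- With `s = t / l(d)` and `l(d) = K_n d^{-α_n}`, the product `s K_j` is the constant `c_{n,j}` of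
  -- the formula.
  have hc : ∀ j, t / pathloss N R α b d * slopeConst R α j
      = t * (slopeConst R α j / slopeConst R α n) * d ^ α n := by
    intro j
    rw [hl]
    field_simp
  have hcn : t / pathloss N R α b d * slopeConst R α n = t * d ^ α n := by
    rw [hc, div_self hKn.ne', mul_one]
  rw [← sq_mul_omega2 hd.le (hα n hn), hcn, exponentTerm]
  simp_rw [hc]
  congr 4
  field_simp

/-- The difference `∫_0^∞ - ∫_0^{d²}` is the tail integral over `(d², ∞)`, which `sq_mul_delta`
evaluates. -/
lemma exponentTerm_one {t d : ℝ} (hα2 : 2 < α 0) (ht : 0 < t) (hd : 0 < d) :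
    exponentTerm 1 R α b t d 0 = d ^ 2 * delta t (α 0) := by
  have hdp : 0 < d ^ α 0 := Real.rpow_pos_of_pos hd _
  have hc : 0 < t * d ^ α 0 := by positivity
  have hint := integrableOn_inv_one_add_rpow hc hα2
  have h1 : d ^ 2 * omega2 (1 / t) (α 0) = d ^ 2 * omega2 (d ^ α 0 / (t * d ^ α 0)) (α 0) := by
    congr 2
    field_simp
  rw [exponentTerm, h1, sq_mul_omega2 hd.le (by linarith), sq_mul_delta hd ht hα2,
    upperTerm_last (N := 1) le_rfl hc hα2, Finset.Ico_self, Finset.sum_empty, add_zero,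
    ← intervalIntegral.integral_interval_add_Ioi hint
      (hint.mono_set (Set.Ioi_subset_Ioi (sq_nonneg d)))]
  ring

end Pathloss

/-! ### Distances to the points of a planar Poisson point process -/

/-- The preimage of `(-∞, c)` is a disc of area `π c` when `c ≥ 0`, and half-open intervals
determine a locally finite measure. -/
lemma map_sq_dist_volume (u : EuclideanSpace ℝ (Fin 2)) :
    (volume : Measure (EuclideanSpace ℝ (Fin 2))).map (fun x => dist x u ^ 2)
      = ENNReal.ofReal Real.pi • volume.restrict (Set.Ici 0) := by
  have hm : Measurable fun x : EuclideanSpace ℝ (Fin 2) => dist x u ^ 2 := by fun_prop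
  have h1 : ∀ c : ℝ, (volume : Measure (EuclideanSpace ℝ (Fin 2))).map (fun x => dist x u ^ 2)
      (Set.Iio c) = ENNReal.ofReal Real.pi * ENNReal.ofReal c := by
    intro c
    have hball : (fun x : EuclideanSpace ℝ (Fin 2) => dist x u ^ 2) ⁻¹' Set.Iio c
        = Metric.ball u (√c) := by
      ext x
      rw [Set.mem_preimage, Set.mem_Iio, Metric.mem_ball, Real.lt_sqrt dist_nonneg]
    rw [Measure.map_apply hm measurableSet_Iio, hball, EuclideanSpace.volume_ball, mul_comm]
    congr 1
    · simp [Real.sq_sqrt Real.pi_pos.le, one_add_one_eq_two]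
    · rcases le_total 0 c with hc | hc
      · simp [← ENNReal.ofReal_pow (Real.sqrt_nonneg c), Real.sq_sqrt hc]
      · simp [Real.sqrt_eq_zero_of_nonpos hc, ENNReal.ofReal_of_nonpos hc]
  have h2 : ∀ c : ℝ, (ENNReal.ofReal Real.pi • volume.restrict (Set.Ici (0 : ℝ))) (Set.Iio c)
      = ENNReal.ofReal Real.pi * ENNReal.ofReal c := by
    intro c
    rw [Measure.smul_apply, smul_eq_mul, Measure.restrict_apply measurableSet_Iio, Set.inter_comm,
      Set.Ici_inter_Iio, Real.volume_Ico, sub_zero]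
  have hfin : ∀ c : ℝ, ENNReal.ofReal Real.pi * ENNReal.ofReal c ≠ ⊤ := fun c =>
    ENNReal.mul_ne_top ENNReal.ofReal_ne_top ENNReal.ofReal_ne_top
  have hIco : ∀ a c : ℝ, Set.Ico a c = Set.Iio c \ Set.Iio a := by
    intro a c
    ext x
    simp
  refine Measure.ext_of_Ico' _ _ (fun a c _ => ?_) fun a c hac => ?_
  · refine ne_top_of_le_ne_top (hfin c) ?_
    rw [← h1 c]
    exact measure_mono Set.Ico_subset_Iio_self
  · rw [hIco, measure_sdiff (Set.Iio_subset_Iio hac.le) measurableSet_Iio.nullMeasurableSet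
      (by rw [h1]; exact hfin a), measure_sdiff (Set.Iio_subset_Iio hac.le)
      measurableSet_Iio.nullMeasurableSet (by rw [h2]; exact hfin a), h1, h1, h2, h2]

lemma IsPoissonPointProcess.sq_dist {Ω : Type*} [MeasurableSpace Ω] {μ : Measure Ω} {lam : ℝ}
    (hlam : 0 < lam) {BS : ℕ → Ω → EuclideanSpace ℝ (Fin 2)}
    (hBS : IsPoissonPointProcess μ BS (ENNReal.ofReal lam • volume))
    (u : EuclideanSpace ℝ (Fin 2)) :
    IsPoissonPointProcess μ (fun i ω => dist (BS i ω) u ^ 2)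
      (ENNReal.ofReal (Real.pi * lam) • volume.restrict (Set.Ici 0)) := by
  have h := hBS.map (f := fun x => dist x u ^ 2) (by fun_prop)
  rwa [Measure.map_smul, map_sq_dist_volume, smul_smul, ← ENNReal.ofReal_mul hlam.le,
    mul_comm lam] at h

/-! ### The law of the serving distance -/

lemma measurable_contactPDF (lam : ℝ) : Measurable (contactPDF lam) :=
  Measurable.ite measurableSet_Ici (by fun_prop) measurable_const

lemma contactPDF_nonneg {lam : ℝ} (hlam : 0 ≤ lam) (x : ℝ) : 0 ≤ contactPDF lam x := by
  rw [contactPDF]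
  split_ifs
  · have := Real.pi_pos
    positivity
  · exact le_rfl

lemma contactPDF_of_neg {lam x : ℝ} (hx : x < 0) : contactPDF lam x = 0 :=
  if_neg (not_le.2 hx)

lemma integral_Ioi_contactPDF {lam : ℝ} (hlam : 0 < lam) {a : ℝ} (ha : 0 ≤ a) :
    IntegrableOn (contactPDF lam) (Set.Ioi a) ∧
    ∫ x in Set.Ioi a, contactPDF lam x = Real.exp (-(Real.pi * lam * a ^ 2)) := by
  have hκ : 0 < Real.pi * lam := mul_pos Real.pi_pos hlam
  let F : ℝ → ℝ := fun x => -Real.exp (-(Real.pi * lam * x ^ 2))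
  have hd : ∀ x ∈ Set.Ioi a, HasDerivAt F (contactPDF lam x) x := by
    intro x hx
    have hx0 : 0 ≤ x := ha.trans (le_of_lt hx)
    have h1 : HasDerivAt (fun x : ℝ => -(Real.pi * lam * x ^ 2)) (-(Real.pi * lam * (2 * x))) x := by
      have := (hasDerivAt_pow 2 x).const_mul (Real.pi * lam)
      simp only [Nat.cast_ofNat, Nat.add_one_sub_one, pow_one] at this
      exact this.neg
    have h2 := h1.exp.neg
    have h3 : contactPDF lam x
        = -(Real.exp (-(Real.pi * lam * x ^ 2)) * -(Real.pi * lam * (2 * x))) := by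
      rw [contactPDF, if_pos hx0, show -Real.pi * lam * x ^ 2 = -(Real.pi * lam * x ^ 2) by ring]
      ring
    rw [h3]
    exact h2
  have hc : ContinuousWithinAt F (Set.Ici a) a := by
    have : Continuous F := by fun_prop
    exact this.continuousWithinAt
  have hlim : Tendsto F atTop (𝓝 0) := by
    have h1 : Tendsto (fun x : ℝ => Real.pi * lam * x ^ 2) atTop atTop :=
      (tendsto_pow_atTop two_ne_zero).const_mul_atTop hκ
    have := (Real.tendsto_exp_neg_atTop_nhds_zero.comp h1).neg
    simpa [F] using this
  refine ⟨integrableOn_Ioi_deriv_of_nonneg hc hd (fun x _ => contactPDF_nonneg hlam.le x) hlim, ?_⟩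
  rw [integral_Ioi_of_hasDerivAt_of_nonneg hc hd (fun x _ => contactPDF_nonneg hlam.le x) hlim]
  simp [F]

lemma integrable_contactPDF {lam : ℝ} (hlam : 0 < lam) : Integrable (contactPDF lam) := by
  rw [← integrableOn_univ, ← Set.Iio_union_Ici (a := (0 : ℝ))]
  refine IntegrableOn.union ?_ ?_
  · exact integrableOn_zero.congr_fun (fun x hx => (contactPDF_of_neg hx).symm) measurableSet_Iio
  · rw [integrableOn_Ici_iff_integrableOn_Ioi]
    exact (integral_Ioi_contactPDF hlam le_rfl).1

lemma lintegral_Ici_contactPDF {lam : ℝ} (hlam : 0 < lam) {a : ℝ} (ha : 0 ≤ a) :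
    ∫⁻ x in Set.Ici a, ENNReal.ofReal (contactPDF lam x)
      = ENNReal.ofReal (Real.exp (-(Real.pi * lam * a ^ 2))) := by
  obtain ⟨hi, hv⟩ := integral_Ioi_contactPDF hlam ha
  rw [← hv, ofReal_integral_eq_lintegral_ofReal hi (ae_of_all _ fun x => contactPDF_nonneg hlam.le x),
    setLIntegral_congr Ioi_ae_eq_Ici]

/-- The weight `h = 0` in `setLIntegral_le_nearest` gives the void probability: no base station lies
within distance `a` with probability `exp(-π λ a²)`. -/
theorem hasLaw_horizDist {Ω : Type*} [MeasurableSpace Ω] {μ : Measure Ω} [IsProbabilityMeasure μ]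
    {lam : ℝ} (hlam : 0 < lam) {u : EuclideanSpace ℝ (Fin 2)}
    {BS : ℕ → Ω → EuclideanSpace ℝ (Fin 2)}
    (hBS : IsPoissonPointProcess μ BS (ENNReal.ofReal lam • volume))
    (hnear : ∀ᵐ ω ∂μ, ∀ i, dist (BS 0 ω) u ≤ dist (BS i ω) u) :
    HasLaw (horizDist u BS 0)
      (volume.withDensity fun x => ENNReal.ofReal (contactPDF lam x)) μ := by
  have hκ : 0 ≤ Real.pi * lam := (mul_pos Real.pi_pos hlam).le
  have hm : Measurable (horizDist u BS 0) := (hBS.measurable 0).dist measurable_const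
  have hρ := hBS.sq_dist hlam u
  have hmin : ∀ᵐ ω ∂μ, ∀ i, dist (BS 0 ω) u ^ 2 ≤ dist (BS i ω) u ^ 2 := by
    filter_upwards [hnear] with ω hω i using pow_le_pow_left₀ dist_nonneg (hω i) 2
  have : IsProbabilityMeasure (μ.map (horizDist u BS 0)) := Measure.isProbabilityMeasure_map
    hm.aemeasurable
  have key : ∀ a : ℝ, 0 ≤ a → μ.map (horizDist u BS 0) (Set.Ici a)
      = (volume.withDensity fun x => ENNReal.ofReal (contactPDF lam x)) (Set.Ici a) := by
    intro a ha
    have h1 := setLIntegral_le_nearest hρ hmin (h := fun _ => 0) measurable_const (sq_nonneg a)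
    simp only [tsum_zero, nexp_zero, lintegral_const, Measure.restrict_apply MeasurableSet.univ,
      Set.univ_inter, one_mul, tsub_self, zero_mul, add_zero] at h1
    rw [← ENNReal.ofReal_mul hκ, nexp_ofReal (by positivity)] at h1
    rw [Measure.map_apply hm measurableSet_Ici, withDensity_apply _ measurableSet_Ici,
      lintegral_Ici_contactPDF hlam ha, ← h1]
    congr 1
    ext ω
    exact (pow_le_pow_iff_left₀ ha dist_nonneg two_ne_zero).symm
  refine ⟨hm.aemeasurable, Measure.ext_of_Ici _ _ fun a => ?_⟩
  rcases le_total 0 a with ha | ha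
  · exact key a ha
  · have h1 : μ.map (horizDist u BS 0) (Set.Ici a) = μ.map (horizDist u BS 0) (Set.Ici 0) := by
      rw [Measure.map_apply hm measurableSet_Ici, Measure.map_apply hm measurableSet_Ici]
      congr 1
      ext ω
      have : 0 ≤ horizDist u BS 0 ω := dist_nonneg
      simp [this, ha.trans this]
    rw [h1, key 0 le_rfl, withDensity_apply _ measurableSet_Ici,
      withDensity_apply _ measurableSet_Ici, ← Set.Ico_union_Ici_eq_Ici ha,
      lintegral_union measurableSet_Ici
        (Set.disjoint_left.2 fun x hx hx' => not_le.2 hx.2 hx'),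
      setLIntegral_congr_fun (g := fun _ => 0) measurableSet_Ico fun x hx => by
        simp only [contactPDF_of_neg hx.2, ENNReal.ofReal_zero]]
    simp

/-! ### Averaging over the fading -/

/-- Cross-multiplication in `[0, ∞]` also covers zero and infinite interference, because the signal
is finite and `τ > 0`. The common factor `P l₀` then cancels. -/
lemma lt_sir_iff {P τ l₀ γ₀ : ℝ} (hP : 0 < P) (hτ : 0 < τ) (hl₀ : 0 < l₀) {l γ : ℕ → ℝ}
    (hl : ∀ i, 0 ≤ l i) :
    ENNReal.ofReal τ < ENNReal.ofReal (P * γ₀ * l₀) / ∑' i, ENNReal.ofReal (P * γ i * l i) ↔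
      ∑' i, ENNReal.ofReal (τ * l i / l₀) * ENNReal.ofReal (γ i) < ENNReal.ofReal γ₀ := by
  have hk : 0 < P * l₀ := mul_pos hP hl₀
  rw [ENNReal.lt_div_iff_mul_lt (Or.inr ENNReal.ofReal_ne_top)
    (Or.inr (ENNReal.ofReal_pos.2 hτ).ne'), ← ENNReal.tsum_mul_left]
  have h1 : ∀ i, ENNReal.ofReal τ * ENNReal.ofReal (P * γ i * l i)
      = ENNReal.ofReal (P * l₀) * (ENNReal.ofReal (τ * l i / l₀) * ENNReal.ofReal (γ i)) := by
    intro i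
    have := hl i
    rw [← ENNReal.ofReal_mul hτ.le, ← ENNReal.ofReal_mul (by positivity),
      ← ENNReal.ofReal_mul hk.le]
    congr 1
    field_simp
  have h2 : ENNReal.ofReal (P * γ₀ * l₀) = ENNReal.ofReal (P * l₀) * ENNReal.ofReal γ₀ := by
    rw [← ENNReal.ofReal_mul hk.le]
    congr 1
    ring
  simp_rw [h1]
  rw [ENNReal.tsum_mul_left, h2,
    ENNReal.mul_lt_mul_iff_right (ENNReal.ofReal_pos.2 hk).ne' ENNReal.ofReal_ne_top]

/-- Gains and locations are independent, so Fubini allows the locations to be frozen while the gains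
are averaged by `measure_tsum_lt_ofReal`. -/
theorem measure_lt_sir {Ω : Type*} [MeasurableSpace Ω] {μ : Measure Ω} [IsProbabilityMeasure μ]
    {N : ℕ} {R α b : ℕ → ℝ} {P τ Δh q r : ℝ} (hP : 0 < P) (hτ : 0 < τ) (hq : 0 < q) (hr : 0 < r)
    (hl : ∀ x, 0 < pathloss N R α b (antennaDist Δh x))
    {u : EuclideanSpace ℝ (Fin 2)} {BS : ℕ → Ω → EuclideanSpace ℝ (Fin 2)}
    (hBS : ∀ i, Measurable (BS i)) {g : ℕ → Ω → ℝ} (hg : ∀ i, Measurable (g i))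
    (hg0 : HasLaw (g 0) (expMeasure q) μ) (hgi : ∀ i, HasLaw (g (i + 1)) (expMeasure r) μ)
    (hgindep : iIndepFun g μ) (hgBS : IndepFun (fun ω i => g i ω) (fun ω i => BS i ω) μ) :
    μ {ω | ENNReal.ofReal τ < sir N R α b P Δh u BS g ω}
      = ∫⁻ ω, nexp (∑' i, logOneAdd (ENNReal.ofReal (q * (τ *
          pathloss N R α b (antennaDist Δh (horizDist u BS (i + 1) ω)) /
          pathloss N R α b (antennaDist Δh (horizDist u BS 0 ω))) / r))) ∂μ := by
  let l : EuclideanSpace ℝ (Fin 2) → ℝ := fun x => pathloss N R α b (antennaDist Δh (dist x u))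
  have hlm : Measurable l := by
    refine measurable_pathloss.comp ?_
    unfold antennaDist
    fun_prop
  let A : Set ((ℕ → ℝ) × (ℕ → EuclideanSpace ℝ (Fin 2))) :=
    {p | ENNReal.ofReal τ < ENNReal.ofReal (P * p.1 0 * l (p.2 0)) /
      ∑' i, ENNReal.ofReal (P * p.1 (i + 1) * l (p.2 (i + 1)))}
  have hterm : ∀ i, Measurable fun p : (ℕ → ℝ) × (ℕ → EuclideanSpace ℝ (Fin 2)) =>
      ENNReal.ofReal (P * p.1 i * l (p.2 i)) := by
    intro i
    have h1 : Measurable fun p : (ℕ → ℝ) × (ℕ → EuclideanSpace ℝ (Fin 2)) => l (p.2 i) :=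
      hlm.comp ((measurable_pi_apply i).comp measurable_snd)
    have h2 : Measurable fun p : (ℕ → ℝ) × (ℕ → EuclideanSpace ℝ (Fin 2)) => p.1 i :=
      (measurable_pi_apply i).comp measurable_fst
    exact ((h2.const_mul P).mul h1).ennreal_ofReal
  have hA : MeasurableSet A :=
    measurableSet_lt measurable_const ((hterm 0).div (Measurable.tsum fun i => hterm (i + 1)))
  have hgm : Measurable fun ω i => g i ω := measurable_pi_lambda _ hg
  have hBm : Measurable fun ω i => BS i ω := measurable_pi_lambda _ hBS
  have : IsProbabilityMeasure (μ.map fun ω i => g i ω) :=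
    Measure.isProbabilityMeasure_map hgm.aemeasurable
  have : IsProbabilityMeasure (μ.map fun ω i => BS i ω) :=
    Measure.isProbabilityMeasure_map hBm.aemeasurable
  have hprod := (indepFun_iff_map_prod_eq_prod_map_map hgm.aemeasurable hBm.aemeasurable).1 hgBS
  have h1 : μ {ω | ENNReal.ofReal τ < sir N R α b P Δh u BS g ω}
      = μ.map (fun ω => ((fun i => g i ω), fun i => BS i ω)) A := by
    rw [Measure.map_apply (hgm.prodMk hBm) hA]
    rfl
  have hslice : Measurable fun x : ℕ → EuclideanSpace ℝ (Fin 2) =>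
      (μ.map fun ω i => g i ω) ((fun γ => (γ, x)) ⁻¹' A) := measurable_measure_prodMk_right hA
  rw [h1, hprod, Measure.prod_apply_symm hA, lintegral_map hslice hBm]
  refine lintegral_congr fun ω => ?_
  rw [Measure.map_apply hgm (measurable_prodMk_right hA)]
  have h2 := measure_tsum_lt_ofReal hg hgindep hq hr hg0 hgi (c := fun i => τ * l (BS (i + 1) ω) /
    l (BS 0 ω)) (fun i => div_nonneg (mul_nonneg hτ.le (hl _).le) (hl _).le)
  refine Eq.trans ?_ h2
  congr 1
  ext ω'
  exact lt_sir_iff hP hτ (hl _) fun i => (hl _).le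

/-! ### The coverage probability -/

lemma antennaDist_pos {Δh : ℝ} (hΔh : 0 < Δh) (r : ℝ) : 0 < antennaDist Δh r :=
  Real.sqrt_pos.2 (by positivity)

lemma le_antennaDist (Δh r : ℝ) : Δh ≤ antennaDist Δh r :=
  Real.le_sqrt_of_sq_le (le_add_of_nonneg_left (sq_nonneg r))

lemma sq_antennaDist (Δh r : ℝ) : antennaDist Δh r ^ 2 = r ^ 2 + Δh ^ 2 :=
  Real.sq_sqrt (by positivity)

lemma measurable_antennaDist (Δh : ℝ) : Measurable (antennaDist Δh) := by
  unfold antennaDist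
  fun_prop

lemma lintegral_Ici_comp_add_right {F : ℝ → ℝ≥0∞} (hF : Measurable F) (v c : ℝ) :
    ∫⁻ w in Set.Ici v, F (w + c) = ∫⁻ x in Set.Ici (v + c), F x := by
  rw [← (measurePreserving_add_right volume c).setLIntegral_comp_preimage measurableSet_Ici hF]
  congr 2
  ext w
  simp

section Coverage

variable {N : ℕ} {R α b : ℕ → ℝ} {t Δh κ : ℝ}

/-- The conditional coverage probability given that the squared horizontal serving distance
is `v`. -/
def conditionalCoverage (N : ℕ) (R α b : ℕ → ℝ) (t Δh κ v : ℝ) : ℝ≥0∞ :=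
  nexp (ENNReal.ofReal κ * ∫⁻ w in Set.Ici v,
    (1 - (1 + ENNReal.ofReal (1 / pathloss N R α b (√(v + Δh ^ 2))) *
      ENNReal.ofReal (t * pathloss N R α b (√(w + Δh ^ 2))))⁻¹))

lemma measurable_conditionalCoverage : Measurable (conditionalCoverage N R α b t Δh κ) := by
  have hl : Measurable fun w : ℝ => pathloss N R α b (√(w + Δh ^ 2)) :=
    measurable_pathloss.comp (by fun_prop)
  exact measurable_nexp.comp ((measurable_lintegral_Ici_mul (hl.const_mul t).ennreal_ofReal
    (hl.const_div 1).ennreal_ofReal).const_mul _)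

lemma conditionalCoverage_sq (hκ : 0 ≤ κ) (hK : ∀ n < N, 0 < slopeConst R α n)
    (hb0 : 0 ≤ b 0) (hb : ∀ n, n + 1 < N → b n < b (n + 1)) (hα : ∀ n < N, 0 ≤ α n)
    (hα2 : 2 < α (N - 1)) (ht : 0 < t) (hΔh : 0 < Δh) {r : ℝ} {n : ℕ} (hn : n < N)
    (hdn : antennaDist Δh r ∈ band N b n) :
    conditionalCoverage N R α b t Δh κ (r ^ 2)
      = ENNReal.ofReal (Real.exp (-(κ * exponentTerm N R α b t (antennaDist Δh r) n))) := by
  have hd := antennaDist_pos hΔh r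
  have hl0 : 0 < pathloss N R α b (antennaDist Δh r) := by
    rw [pathloss_of_mem_band hb hn hdn]
    exact mul_pos (hK n hn) (Real.rpow_pos_of_pos hd _)
  obtain ⟨hI, hv⟩ := exponentTerm_eq_integral hK hb0 hb hα hα2 ht hd hn hdn
  set s := t / pathloss N R α b (antennaDist Δh r) with hs
  have hs0 : 0 < s := div_pos ht hl0
  have hlnn : ∀ x : ℝ, 0 ≤ pathloss N R α b (√x) := fun x => pathloss_nonneg hK (Real.sqrt_nonneg x)
  have hwm : Measurable (interferenceWeight N R α b s) := by
    have hl : Measurable fun x : ℝ => pathloss N R α b (√x) := measurable_pathloss.comp (by fun_prop)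
    exact measurable_const.sub (measurable_const.add (hl.const_mul s)).inv
  have hw0 : ∀ x, 0 ≤ interferenceWeight N R α b s x := fun x => by
    have := hlnn x
    exact sub_nonneg.2 (inv_le_one_of_one_le₀ (le_add_of_nonneg_right (by positivity)))
  have hint : ∀ w : ℝ, 1 - (1 + ENNReal.ofReal (1 / pathloss N R α b (√(r ^ 2 + Δh ^ 2))) *
      ENNReal.ofReal (t * pathloss N R α b (√(w + Δh ^ 2))))⁻¹
      = ENNReal.ofReal (interferenceWeight N R α b s (w + Δh ^ 2)) := by
    intro w
    have hlw := hlnn (w + Δh ^ 2)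
    have h1 : 1 / pathloss N R α b (√(r ^ 2 + Δh ^ 2)) * (t * pathloss N R α b (√(w + Δh ^ 2)))
        = s * pathloss N R α b (√(w + Δh ^ 2)) := by
      rw [hs, antennaDist]
      ring
    rw [← ENNReal.ofReal_mul (one_div_nonneg.2 (hlnn _)), h1, interferenceWeight,
      ENNReal.ofReal_sub _ (by positivity), ENNReal.ofReal_one,
      ENNReal.ofReal_inv_of_pos (by positivity), ENNReal.ofReal_add zero_le_one (by positivity),
      ENNReal.ofReal_one]
  rw [conditionalCoverage]
  simp_rw [hint]
  rw [lintegral_Ici_comp_add_right hwm.ennreal_ofReal, ← sq_antennaDist,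
    setLIntegral_congr Ioi_ae_eq_Ici.symm,
    ← ofReal_integral_eq_lintegral_ofReal hI (ae_of_all _ hw0), hv, ← ENNReal.ofReal_mul hκ,
    nexp_ofReal (mul_nonneg hκ (hv ▸ integral_nonneg hw0))]

/-- As `b 0 ≤ Δh`, the bands partition all serving distances `r ≥ 0`. The conditional coverage is at
most `1`, so `contactPDF` dominates the integrand. -/
lemma integral_conditionalCoverage {lam : ℝ} (hlam : 0 < lam) (hN : 1 ≤ N)
    (hK : ∀ n < N, 0 < slopeConst R α n) (hb0 : 0 ≤ b 0) (hbΔ : b 0 ≤ Δh)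
    (hb : ∀ n, n + 1 < N → b n < b (n + 1)) (hα : ∀ n < N, 0 ≤ α n)
    (hα2 : 2 < α (N - 1)) (ht : 0 < t) (hΔh : 0 < Δh) :
    (∫⁻ r, conditionalCoverage N R α b t Δh (Real.pi * lam) (r ^ 2) *
        ENNReal.ofReal (contactPDF lam r)).toReal
      = ∑ n ∈ Finset.range N, ∫ r in {r : ℝ | 0 ≤ r ∧ antennaDist Δh r ∈ band N b n},
          Real.exp (-Real.pi * lam * exponentTerm N R α b t (antennaDist Δh r) n) *
            contactPDF lam r := by
  let G : ℝ → ℝ := fun r => (conditionalCoverage N R α b t Δh (Real.pi * lam) (r ^ 2)).toReal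
  have hGm : Measurable G :=
    (measurable_conditionalCoverage.comp (measurable_id.pow_const 2)).ennreal_toReal
  have hG0 : ∀ r, 0 ≤ G r := fun r => ENNReal.toReal_nonneg
  have hG1 : ∀ r, G r ≤ 1 := fun r =>
    ENNReal.toReal_le_of_le_ofReal zero_le_one (ENNReal.ofReal_one ▸ nexp_le_one _)
  have hGc : ∀ r, conditionalCoverage N R α b t Δh (Real.pi * lam) (r ^ 2) *
      ENNReal.ofReal (contactPDF lam r) = ENNReal.ofReal (G r * contactPDF lam r) := fun r => by
    have h : conditionalCoverage N R α b t Δh (Real.pi * lam) (r ^ 2) ≠ ⊤ := nexp_ne_top _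
    rw [ENNReal.ofReal_mul (hG0 r), ENNReal.ofReal_toReal h]
  have hi : Integrable fun r => G r * contactPDF lam r := by
    refine (integrable_contactPDF hlam).mono'
      (hGm.mul (measurable_contactPDF lam)).aestronglyMeasurable (ae_of_all _ fun r => ?_)
    rw [Real.norm_of_nonneg (mul_nonneg (hG0 r) (contactPDF_nonneg hlam.le r))]
    exact mul_le_of_le_one_left (contactPDF_nonneg hlam.le r) (hG1 r)
  simp_rw [hGc]
  rw [← ofReal_integral_eq_lintegral_ofReal hi
      (ae_of_all _ fun r => mul_nonneg (hG0 r) (contactPDF_nonneg hlam.le r)),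
    ENNReal.toReal_ofReal (integral_nonneg fun r =>
      mul_nonneg (hG0 r) (contactPDF_nonneg hlam.le r))]
  have hSm : ∀ n, MeasurableSet {r : ℝ | 0 ≤ r ∧ antennaDist Δh r ∈ band N b n} := fun n =>
    measurableSet_Ici.inter (measurable_antennaDist Δh (measurableSet_band n))
  have hunion : Set.Ici (0 : ℝ)
      = ⋃ n ∈ Finset.range N, {r : ℝ | 0 ≤ r ∧ antennaDist Δh r ∈ band N b n} := by
    ext r
    simp only [Set.mem_iUnion, Finset.mem_range, Set.mem_Ici]
    constructor
    · intro hr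
      obtain ⟨n, hn, hdn⟩ := exists_mem_band (b := b) hN (hbΔ.trans (le_antennaDist Δh r))
      exact ⟨n, hn, hr, hdn⟩
    · rintro ⟨n, _, hr, _⟩
      exact hr
  have hzero : ∀ r, r ∉ Set.Ici (0 : ℝ) → G r * contactPDF lam r = 0 := fun r hr => by
    rw [contactPDF_of_neg (not_le.1 hr), mul_zero]
  rw [← setIntegral_eq_integral_of_forall_compl_eq_zero hzero, hunion,
    integral_biUnion_finset _ (fun n _ => hSm n) ?_ fun n _ => hi.integrableOn]
  · refine Finset.sum_congr rfl fun n hn => setIntegral_congr_fun (hSm n) fun r hr => ?_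
    have h1 := conditionalCoverage_sq (mul_pos Real.pi_pos hlam).le hK hb0 hb hα hα2 ht hΔh
      (Finset.mem_range.1 hn) hr.2
    simp only [G]
    rw [h1, ENNReal.toReal_ofReal (Real.exp_pos _).le, ← neg_mul, ← neg_mul]
  · intro n hn m hm hnm
    refine Set.disjoint_left.2 fun r hr hr' => hnm ?_
    exact eq_of_mem_band hb (Finset.mem_range.1 hn) (Finset.mem_range.1 hm) hr.2 hr'.2

lemma delta_nonneg {t y : ℝ} (ht : 0 < t) (hy : 2 < y) : 0 ≤ delta t y := by
  have h := sq_mul_delta one_pos ht hy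
  rw [one_pow, one_mul] at h
  rw [h]
  refine setIntegral_nonneg measurableSet_Ioi fun v hv => ?_
  have hv0 : 0 < v := one_pos.trans hv
  rw [Real.one_rpow]
  positivity

/-- The factor `exp(-π λ δ r²)` turns the contact density for `λ` into `1 / (1 + δ)` times the one
for `λ (1 + δ)`. -/
lemma integral_exp_mul_contactPDF {lam δ : ℝ} (hlam : 0 < lam) (hδ : 0 ≤ δ) (Δh : ℝ) :
    ∫ r in Set.Ici 0, Real.exp (-Real.pi * lam * ((r ^ 2 + Δh ^ 2) * δ)) * contactPDF lam r
      = 1 / (1 + δ) * Real.exp (-Real.pi * lam * δ * Δh ^ 2) := by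
  have hδ1 : 0 < 1 + δ := by linarith
  have h1 : ∀ r ∈ Set.Ici (0 : ℝ),
      Real.exp (-Real.pi * lam * ((r ^ 2 + Δh ^ 2) * δ)) * contactPDF lam r
      = 1 / (1 + δ) * Real.exp (-Real.pi * lam * δ * Δh ^ 2) * contactPDF (lam * (1 + δ)) r := by
    intro r hr
    rw [contactPDF, contactPDF, if_pos (Set.mem_Ici.1 hr), if_pos (Set.mem_Ici.1 hr)]
    have h2 : Real.exp (-Real.pi * lam * ((r ^ 2 + Δh ^ 2) * δ)) * Real.exp (-Real.pi * lam * r ^ 2)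
        = Real.exp (-Real.pi * lam * δ * Δh ^ 2) *
          Real.exp (-Real.pi * (lam * (1 + δ)) * r ^ 2) := by
      rw [← Real.exp_add, ← Real.exp_add]
      congr 1
      ring
    calc _ = 2 * Real.pi * lam * r * (Real.exp (-Real.pi * lam * ((r ^ 2 + Δh ^ 2) * δ)) *
          Real.exp (-Real.pi * lam * r ^ 2)) := by ring
      _ = _ := by
        rw [h2]
        field_simp
  rw [setIntegral_congr_fun measurableSet_Ici h1, integral_const_mul, integral_Ici_eq_integral_Ioi,
    (integral_Ioi_contactPDF (mul_pos hlam hδ1) le_rfl).2]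
  simp

lemma coverageFormula_eq {lam : ℝ} (hlam : 0 < lam)
    (hbΔ : b 0 ≤ Δh) (hα2 : 2 < α (N - 1)) (ht : 0 < t) (hΔh : 0 < Δh) :
    coverageFormula N R α b Δh lam t
      = ∑ n ∈ Finset.range N, ∫ r in {r : ℝ | 0 ≤ r ∧ antennaDist Δh r ∈ band N b n},
          Real.exp (-Real.pi * lam * exponentTerm N R α b t (antennaDist Δh r) n) *
            contactPDF lam r := by
  by_cases h : N = 1
  · subst h
    rw [coverageFormula, if_pos rfl, Finset.sum_range_one,
      ← integral_exp_mul_contactPDF hlam (delta_nonneg ht hα2)]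
    have hset : {r : ℝ | 0 ≤ r ∧ antennaDist Δh r ∈ band 1 b 0} = Set.Ici 0 := by
      ext r
      refine ⟨fun hr => hr.1, fun hr => ⟨hr, hbΔ.trans (le_antennaDist Δh r), fun h => ?_⟩⟩
      omega
    rw [hset]
    refine setIntegral_congr_fun measurableSet_Ici fun r _ => ?_
    rw [exponentTerm_one hα2 ht (antennaDist_pos hΔh r), sq_antennaDist]
  · rw [coverageFormula, if_neg h]

end Coverage

theorem coverageProb_sir {Ω : Type*} [MeasurableSpace Ω] {μ : Measure Ω} [IsProbabilityMeasure μ]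
    {lam P τ Δh a : ℝ} (hlam : 0 < lam) (hP : 0 < P) (hτ : 0 < τ) (hΔh : 0 < Δh) (ha : 0 < a)
    {N : ℕ} (hN : 1 ≤ N) {R α b : ℕ → ℝ}
    (hK : ∀ n < N, 0 < slopeConst R α n) (hb0 : 0 ≤ b 0) (hbΔ : b 0 ≤ Δh)
    (hb : ∀ n, n + 1 < N → b n < b (n + 1)) (hα : ∀ n < N, 0 ≤ α n) (hα2 : 2 < α (N - 1))
    {u : EuclideanSpace ℝ (Fin 2)} {BS : ℕ → Ω → EuclideanSpace ℝ (Fin 2)}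
    (hBS : IsPoissonPointProcess μ BS (ENNReal.ofReal lam • volume))
    (hnear : ∀ᵐ ω ∂μ, ∀ i, dist (BS 0 ω) u ≤ dist (BS i ω) u)
    {g : ℕ → Ω → ℝ} (hg : ∀ i, Measurable (g i))
    (hg0 : HasLaw (g 0) (expMeasure (1 / (2 * a))) μ)
    (hgi : ∀ i, HasLaw (g (i + 1)) (chiSquare 2) μ)
    (hgindep : iIndepFun g μ) (hgBS : IndepFun (fun ω i => g i ω) (fun ω i => BS i ω) μ) :
    coverageProb μ (sir N R α b P Δh u BS g) τ = coverageFormula N R α b Δh lam (τ / a) := by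
  have ht : 0 < τ / a := div_pos hτ ha
  have hlpos : ∀ x, 0 < pathloss N R α b (antennaDist Δh x) := fun x =>
    pathloss_pos hN hK hb (antennaDist_pos hΔh x) (hbΔ.trans (le_antennaDist Δh x))
  -- The chi-square law with two degrees of freedom is the gamma law of shape `1` and rate `1 / 2`.
  -- Against the rate `1 / (2 a)` of the desired gain this leaves the threshold `τ / a`.
  have hgi' : ∀ i, HasLaw (g (i + 1)) (expMeasure (1 / 2)) μ := by
    intro i
    have := hgi i
    rwa [chiSquare, Nat.cast_ofNat, div_self two_ne_zero] at this
  rw [coverageFormula_eq hlam hbΔ hα2 ht hΔh,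
    ← integral_conditionalCoverage hlam hN hK hb0 hbΔ hb hα hα2 ht hΔh, coverageProb,
    measureReal_def, measure_lt_sir hP hτ (by positivity) (by norm_num : (0 : ℝ) < 1 / 2) hlpos
      hBS.measurable hg hg0 hgi' hgindep hgBS]
  congr 1
  have hlm : Measurable fun w : ℝ => pathloss N R α b (√(w + Δh ^ 2)) :=
    measurable_pathloss.comp (by fun_prop)
  have hfin : ∫⁻ w in Set.Ici 0, ENNReal.ofReal (τ / a * pathloss N R α b (√(w + Δh ^ 2))) ≠ ⊤ := by
    simp_rw [ENNReal.ofReal_mul ht.le]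
    rw [lintegral_const_mul _ hlm.ennreal_ofReal]
    exact ENNReal.mul_ne_top ENNReal.ofReal_ne_top (lintegral_pathloss_ne_top hN hK hα hα2 hΔh)
  have hmin : ∀ᵐ ω ∂μ, ∀ i, dist (BS 0 ω) u ^ 2 ≤ dist (BS i ω) u ^ 2 := by
    filter_upwards [hnear] with ω hω i using pow_le_pow_left₀ dist_nonneg (hω i) 2
  -- Here `L` is `τ / a` times the pathloss, and `θ` is the reciprocal pathloss of the serving
  -- station.
  have key := lintegral_nexp_tsum_nearest (mul_pos Real.pi_pos hlam) (hBS.sq_dist hlam u)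
    (fun ω => sq_nonneg _) hmin (hlm.const_mul (τ / a)).ennreal_ofReal
    (fun w => ENNReal.ofReal_ne_top) hfin (hlm.const_div 1).ennreal_ofReal
  have hlaw := hasLaw_horizDist hlam hBS hnear
  have hcm : Measurable fun r : ℝ => conditionalCoverage N R α b (τ / a) Δh (Real.pi * lam) (r ^ 2) :=
    measurable_conditionalCoverage.comp (measurable_id.pow_const 2)
  have h1 := hlaw.lintegral_comp (f := fun r => conditionalCoverage N R α b (τ / a) Δh
    (Real.pi * lam) (r ^ 2)) hcm.aemeasurable
  rw [lintegral_withDensity_eq_lintegral_mul _ (measurable_contactPDF lam).ennreal_ofReal hcm] at h1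
  refine Eq.trans ?_ (key.trans (h1.trans (lintegral_congr fun r => mul_comm _ _)))
  refine lintegral_congr fun ω => ?_
  congr 1
  refine tsum_congr fun i => ?_
  have hl0 := hlpos (horizDist u BS 0 ω)
  change _ = logOneAdd (ENNReal.ofReal (1 / pathloss N R α b (antennaDist Δh (horizDist u BS 0 ω))) *
    ENNReal.ofReal (τ / a * pathloss N R α b (antennaDist Δh (horizDist u BS (i + 1) ω))))
  rw [← ENNReal.ofReal_mul (one_div_nonneg.2 hl0.le)]
  congr 2
  field_simp

end CellNet

end

/-! ### The main theorem -/

theorem proposition2 {Ω : Type*} [MeasurableSpace Ω] (μ : Measure Ω) [IsProbabilityMeasure μ]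
    -- density, transmit power, decoding threshold, antenna height difference, number of antennas
    (lam P τ Δh : ℝ) (hlam : 0 < lam) (hP : 0 < P) (hτ : 0 < τ) (hΔh : 0 < Δh)
    (Na : ℕ) (hNa : 1 ≤ Na)
    -- multi-slope pathloss parameters
    (N : ℕ) (hN : 1 ≤ N) (R α : ℕ → ℝ) (hR0 : R 0 = 0) (hR : ∀ n, n + 1 < N → R n < R (n + 1))
    (hα0 : 0 ≤ α 0) (hα : ∀ n, n + 1 < N → α n ≤ α (n + 1)) (hα2 : 2 < α (N - 1))
    -- band edges in terms of antenna distance: the `R n` are thresholds either for the horizontal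
    -- distance or for the antenna distance
    (b : ℕ → ℝ) (hb : (∀ n, b n = √(R n ^ 2 + Δh ^ 2)) ∨ (∀ n, b n = R n))
    -- the user, the Poisson base stations, labelled so that the serving one `BS 0` is the nearest
    (u : EuclideanSpace ℝ (Fin 2)) (BS : ℕ → Ω → EuclideanSpace ℝ (Fin 2))
    (hBS : CellNet.IsPoissonPointProcess μ BS (ENNReal.ofReal lam • volume))
    (hnear : ∀ᵐ ω ∂μ, ∀ i, dist (BS 0 ω) u ≤ dist (BS i ω) u)
    -- channel power gains: exponential with mean `2 * Na` for the desired link, chi-square with two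
    -- degrees of freedom for the interfering links
    (g : ℕ → Ω → ℝ) (hg : ∀ i, Measurable (g i))
    (hg0 : HasLaw (g 0) (expMeasure (1 / (2 * (Na : ℝ)))) μ)
    (hgi : ∀ i, HasLaw (g (i + 1)) (CellNet.chiSquare 2) μ)
    (hgindep : iIndepFun g μ)
    (hgBS : IndepFun (fun ω i => g i ω) (fun ω i => BS i ω) μ) :
    -- distribution of the serving distance
    HasLaw (CellNet.horizDist u BS 0)
      (volume.withDensity fun x => ENNReal.ofReal (CellNet.contactPDF lam x)) μ ∧
    -- the limits that define the terms at the infinite upper edge exist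
    (∀ c : ℝ, 0 < c → ∃ L : ℝ, Tendsto
      (fun x : ℝ => x ^ 2 * CellNet.omega2 (x ^ α (N - 1) / c) (α (N - 1))) atTop (𝓝 L)) ∧
    -- coverage probability
    CellNet.coverageProb μ (CellNet.sir N R α b P Δh u BS g) τ =
      CellNet.coverageFormula N R α b Δh lam (τ / Na) ∧
    -- the single-slope case
    (N = 1 → CellNet.coverageProb μ (CellNet.sir N R α b P Δh u BS g) τ =
      Real.exp (-Real.pi * lam * CellNet.delta (τ / Na) (α 0) * Δh ^ 2) /
        (1 + CellNet.delta (τ / Na) (α 0))) ∧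
    -- spatial throughput
    CellNet.spatialThroughput μ (CellNet.sir N R α b P Δh u BS g) lam τ =
      lam * CellNet.coverageFormula N R α b Δh lam (τ / Na) * Real.logb 2 (1 + τ) := by
  have hNa' : (0 : ℝ) < Na := by exact_mod_cast hNa
  have hRmono : ∀ n < N, 0 ≤ R n := fun n hn =>
    hR0 ▸ CellNet.edge_le_edge hR (Nat.zero_le n) hn
  have hαnn : ∀ n < N, 0 ≤ α n := by
    intro n
    induction n with
    | zero => exact fun _ => hα0
    | succ k ih => exact fun hk => (ih (by omega)).trans (hα k hk)
  have hK : ∀ n < N, 0 < CellNet.slopeConst R α n := fun n hn => CellNet.slopeConst_pos hR0 hR hn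
  have hb0 : 0 ≤ b 0 := by
    rcases hb with hb | hb
    · rw [hb]
      exact Real.sqrt_nonneg _
    · rw [hb, hR0]
  -- The lowest edge is `Δh` in the horizontal convention and `0` in the other; either way no
  -- antenna distance falls below every band.
  have hbΔ : b 0 ≤ Δh := by
    rcases hb with hb | hb
    · rw [hb, hR0, zero_pow two_ne_zero, zero_add, Real.sqrt_sq hΔh.le]
    · rw [hb, hR0]
      exact hΔh.le
  have hbmono : ∀ n, n + 1 < N → b n < b (n + 1) := by
    intro n hn
    rcases hb with hb | hb
    · rw [hb, hb]
      have h1 := hRmono n (by omega)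
      have h2 := hR n hn
      exact Real.sqrt_lt_sqrt (by positivity) (by gcongr)
    · rw [hb, hb]
      exact hR n hn
  have hcov := CellNet.coverageProb_sir hlam hP hτ hΔh hNa' hN hK hb0 hbΔ hbmono hαnn hα2 hBS hnear
    hg hg0 hgi hgindep hgBS
  refine ⟨CellNet.hasLaw_horizDist hlam hBS hnear, fun c hc =>
    ⟨_, CellNet.tendsto_sq_mul_omega2 hc hα2⟩, hcov, fun hN1 => ?_, ?_⟩
  · rw [hcov, CellNet.coverageFormula, if_pos hN1, one_div_mul_eq_div]
  · rw [CellNet.spatialThroughput, hcov]
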